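/- For even $m\ge 2$ and $k\ge 0$ define $A_{m,k}\in\mathbb R^{m\times m}$ recursively: $A_{2,k}=\begin{pmatrix}k+1&0\\k+2&k+3\end{pmatrix}$, and for $m\ge 4$ the matrix $A_{m,k}$ has entry $k+1$ at $(1,1)$, $k+2$ at $(m,1)$, $k+3$ at $(m,m)$, $k+4$ at $(2,m)$, the block $A_{m-2,k+4}$ in rows and columns $2,\dots,m-1$, and $0$ elsewhere. Let $A=A_{m,0}$, whose nonzero entries are $1,2,\dots,2m-1$ (a spiral). For even $m\ge 4$ and $n\in\{m+1,m+2\}$ let $B\in\mathbb R^{n\times n}$ be the matrix with $B[a,b]=A[a,b]$ for $a,b\le m$, $B[m+1,1]=B[1,m+1]=\tfrac12$, and $0$ elsewhere (so for $n=m+2$ there is one additional dummy action per player whose payoffs are all $0$; in this way every size $n\ge 5$ occurs). Consider the two-player identical-interest game in which both players receive $\langle x_1,Bx_2\rangle$, $x_1,x_2\in\Delta([n])$. Regret matching (RM): both players start with regret vectors $r_1^{(0)}=r_2^{(0)}=0$ and with the pure strategy on action $m+1$. In each round, player $i$ with regret vector $r_i$ and strategy $x_i$ observes a utility vector $u_i$,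 sets $r_i'=r_i+u_i-\langle x_i,u_i\rangle\mathbf 1$, and moves to $x_i'=[r_i']^+/\|[r_i']^+\|_1$ if $[r_i']^+\ne 0$, and to $x_i'=x_i$ otherwise. With simultaneous updates, $u_1=Bx_2$ and $u_2=B^\top x_1$; with alternating updates, player 1 updates first, $u_1=Bx_2$, and then player 2 updates with $u_2=B^\top x_1'$. A profile $(x_1,x_2)$ is an $\epsilon$-Nash equilibrium if no player can gain more than $\epsilon$ by a unilateral deviation. Theorem. (1) There is an absolute constant $c>0$ such that for all even $m\ge4$ and $n\in\{m+1,m+2\}$, under simultaneous RM as well as under alternating RM, if the strategy profile after $t$ rounds is a $\frac1{2n}$-Nash equilibrium of the $n\times n$ game $B$, then $t\ge n^{cn}$. That is, both simultaneous and alternating RM need $n^{\Omega(n)}$ rounds to reach a $\frac1{2n}$-Nash equilibrium. (2) For either kind of updates and every $4\le k\le 2m-2$, the action profiles with payoff $k$ and with payoff $k+1$ are each eventually played with positive probability, and the number $T_k$ of rounds between the first round in which the profile with payoff $k$ is played with positive probability and the first round in which the one with payoff $k+1$ is, satisfies $T_k\ge \frac{(k-2)!}{2^{k-3}}$. -/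

import Mathlib

open Matrix

/-- Entry in row `a` and column `b` (both counted from `0`) of the `m × m` spiral matrix
`A_{m,k}`, for even `m ≥ 2`:
`A_{2,k} = [[k+1, 0], [k+2, k+3]]`, and `A_{m,k}` has `k+1` in its upper left corner, `k+2` in
its lower left corner, `k+3` in its lower right corner, `k+4` in the last column just below the
upper right corner, `A_{m-2,k+4}` in the middle, and `0` elsewhere. (Odd `m` is never used.) -/
def spiral : ℕ → ℕ → ℕ → ℕ → ℕ
  | 0, _, _, _ => 0
  | 1, _, _, _ => 0
  | 2, k, a, b =>
    if a = 0 ∧ b = 0 then k + 1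
    else if a = 1 ∧ b = 0 then k + 2
    else if a = 1 ∧ b = 1 then k + 3
    else 0
  | m + 3, k, a, b =>
    if a = 0 ∧ b = 0 then k + 1
    else if a = m + 2 ∧ b = 0 then k + 2
    else if a = m + 2 ∧ b = m + 2 then k + 3
    else if a = 1 ∧ b = m + 2 then k + 4
    else if 1 ≤ a ∧ a ≤ m + 1 ∧ 1 ≤ b ∧ b ≤ m + 1 then spiral (m + 1) (k + 4) (a - 1) (b - 1)
    else 0

/-- The common payoff matrix: the spiral matrix `A_{m,0}` on the actions `0, …, m-1`, and one more
action `m`, with payoff `1/2` at the entries `(m, 0)` and `(0, m)`; all other entries are `0`.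
For `n = m + 1` this is the whole game; for `n > m + 1` the actions `m+1, …, n-1` are dummies that
pay `0` against everything. -/
noncomputable def spiralGame (m n : ℕ) : Matrix (Fin n) (Fin n) ℝ :=
  Matrix.of fun a b =>
    if a.val < m ∧ b.val < m then (spiral m 0 a.val b.val : ℝ)
    else if (a.val = m ∧ b.val = 0) ∨ (a.val = 0 ∧ b.val = m) then 1 / 2
    else 0

/-- The pure strategy on the action `i`. -/
def pureStrategy (n i : ℕ) : Fin n → ℝ := fun a => if a.val = i then 1 else 0

/-- `(x, y)` is an `ε`-Nash equilibrium of the two-player identical-interest game in which both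
players receive `⟨x, A y⟩`. -/
def IsApproxNash {n : ℕ} (A : Matrix (Fin n) (Fin n) ℝ) (ε : ℝ) (x y : Fin n → ℝ) : Prop :=
  x ∈ stdSimplex ℝ (Fin n) ∧ y ∈ stdSimplex ℝ (Fin n) ∧
    (∀ x' ∈ stdSimplex ℝ (Fin n), x' ⬝ᵥ (A *ᵥ y) ≤ x ⬝ᵥ (A *ᵥ y) + ε) ∧
    (∀ y' ∈ stdSimplex ℝ (Fin n), x ⬝ᵥ (A *ᵥ y') ≤ x ⬝ᵥ (A *ᵥ y) + ε)

/-- The strategy that regret matching plays at cumulative regrets `r`: proportional to the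
nonnegative part of `r`, or the previous strategy `x` if that part vanishes. -/
noncomputable def rmStrategy {n : ℕ} (r x : Fin n → ℝ) : Fin n → ℝ :=
  open Classical in
  if ∀ a, r a ≤ 0 then x else fun a => max (r a) 0 / ∑ b, max (r b) 0

/-- Regret matching's update of the cumulative regrets `r`, when the strategy `x` was played and
the utility vector `u` is observed. The regrets are not truncated. -/
noncomputable def regretUpdate {n : ℕ} (r x u : Fin n → ℝ) : Fin n → ℝ :=
  fun a => r a + u a - x ⬝ᵥ u

/-- State of the dynamics: cumulative regrets `r₁, r₂` and current strategies `x₁, x₂` of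
player 1 (rows) and player 2 (columns). -/
structure RMState (n : ℕ) where
  r₁ : Fin n → ℝ
  x₁ : Fin n → ℝ
  r₂ : Fin n → ℝ
  x₂ : Fin n → ℝ

/-- The two orders of updates within a round. -/
inductive UpdateMode
  | simultaneous
  | alternating

/-- One round of regret matching by both players. With simultaneous updates, both players observe
the utility vector given by the other player's current strategy. With alternating updates,
player 1 updates first, and player 2 observes the utility vector given by player 1's new
strategy. -/
noncomputable def rmRound {n : ℕ} (A : Matrix (Fin n) (Fin n) ℝ) (mode : UpdateMode)
    (s : RMState n) : RMState n :=
  let r₁' := regretUpdate s.r₁ s.x₁ (A *ᵥ s.x₂)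
  let x₁' := rmStrategy r₁' s.x₁
  let u₂ := match mode with
    | .simultaneous => Aᵀ *ᵥ s.x₁
    | .alternating => Aᵀ *ᵥ x₁'
  let r₂' := regretUpdate s.r₂ s.x₂ u₂
  let x₂' := rmStrategy r₂' s.x₂
  ⟨r₁', x₁', r₂', x₂'⟩

/-- The state after `t` rounds, when all regrets start at `0` and the strategies at `x`, `y`. -/
noncomputable def rmState {n : ℕ} (A : Matrix (Fin n) (Fin n) ℝ) (mode : UpdateMode)
    (x y : Fin n → ℝ) : ℕ → RMState n
  | 0 => ⟨0, x, 0, y⟩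
  | t + 1 => rmRound A mode (rmState A mode x y t)

/-- Regret matching on the spiral game, started from the pure profile in which both players play
the action `m`: the state after `t` rounds. -/
noncomputable def spiralRM (m n : ℕ) (mode : UpdateMode) (t : ℕ) : RMState n :=
  rmState (spiralGame m n) mode (pureStrategy n m) (pureStrategy n m) t

/-- After `t` rounds, an action profile with payoff `k` is played with positive probability. -/
def PlaysPayoff (m n : ℕ) (mode : UpdateMode) (k t : ℕ) : Prop :=
  ∃ a b : Fin n, spiralGame m n a b = (k : ℝ) ∧
    0 < (spiralRM m n mode t).x₁ a ∧ 0 < (spiralRM m n mode t).x₂ b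

/-! Consecutive entries of the spiral alternately share a column and a row. So the actions can be
numbered along a path, rows at odd and columns at even positions, such that positions k and k+1 pay
k against each other and almost everything else pays 0 (`exists_isPathGame`). Regret matching climbs
this path one position at a time. Phase k lasts from the first play of positions k, k+1 to the first
play of k+1, k+2.

In phase k the owner of position k plays it purely, and the opponent mixes k+1 and k-1, with weight
q < 1 on k-1. Per round, the regret of k+2 changes by 1 - kq, so it gains at most 1, while every
position from k+3 on loses k - q ≥ k - 1. Hence T rounds of phase k push the regret of k+3 down to
about -(k-1)T, and phase k+1 must repay this debt at a rate of at most 1 per round. Each phase is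
therefore at least about k-1 times as long as the previous one, which gives factorial growth
(`IsPathDynamics.exists_next_phaseStart`).

For the induction, the positive regrets must stay small. The opponent's two regrets evolve
autonomously (`mixSeq`): that of k-1 is exhausted within 4k-10 rounds (`mixSeq_snd_nonpos`), and a
potential argument bounds that of k+1 by k - 1/2 (`mixSeq_fst_le`). So the opponent is pure at k+1
when the phase ends, and the same bounds hold one position further. The first rounds are computed by
hand (`IsPathDynamics.exists_phaseStart_three`).

No phase up to 2m-2 contains an approximate equilibrium: if q is not small the opponent gains by
dropping k-1, otherwise the owner of k gains by moving to k+2 (`InPhase.not_isApproxNash`). Phase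
2m-2 alone lasts more than (2m-4)! rounds. -/

/-! ### Payoffs along the path -/

/-- Payoff of two actions as a function of their positions on the path of actions along which the
spiral winds: consecutive positions `k`, `k + 1` in `1, …, 2m` pay `k`. -/
noncomputable def pathPay (m i j : ℕ) : ℝ :=
  if i = 0 ∨ j = 0 then (if i + j = 1 ∨ i + j = 2 then 1 / 2 else 0)
  else if i = j + 1 ∧ i ≤ 2 * m then j
  else if j = i + 1 ∧ j ≤ 2 * m then i
  else 0

lemma pathPay_comm (m i j : ℕ) : pathPay m i j = pathPay m j i := by
  unfold pathPay
  by_cases h : i = 0 ∨ j = 0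
  · rw [if_pos h, if_pos h.symm, add_comm]
  · have h' : ¬(j = 0 ∨ i = 0) := fun h' => h h'.symm
    rw [if_neg h, if_neg h']
    split_ifs <;> first | rfl | (exfalso; omega)

lemma pathPay_succ {m k : ℕ} (h1 : 1 ≤ k) (h2 : k + 1 ≤ 2 * m) : pathPay m k (k + 1) = k := by
  unfold pathPay
  rw [if_neg (by omega), if_neg (by omega), if_pos ⟨rfl, h2⟩]

lemma pathPay_pred {m k : ℕ} (h1 : 2 ≤ k) (h2 : k ≤ 2 * m) :
    pathPay m k (k - 1) = (k : ℝ) - 1 := by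
  obtain ⟨j, rfl⟩ : ∃ j, k = j + 1 := ⟨k - 1, by omega⟩
  rw [pathPay_comm, Nat.add_sub_cancel, pathPay_succ (by omega) h2]
  push_cast
  ring

lemma pathPay_succ_le (m k : ℕ) (h : 1 ≤ k) : pathPay m (k + 1) k ≤ k := by
  unfold pathPay
  rw [if_neg (by omega)]
  split_ifs <;> first | (exfalso; omega) | simp

lemma pathPay_eq_zero {m i j : ℕ} (hj : 1 ≤ j) (hi : j + 2 ≤ i) : pathPay m i j = 0 := by
  unfold pathPay
  rw [if_neg (by omega), if_neg (by omega), if_neg (by omega)]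

lemma pathPay_le_half {m i j : ℕ} (h1 : i ≠ j + 1) (h2 : j ≠ i + 1 ∨ i = 0) :
    pathPay m i j ≤ 1 / 2 := by
  unfold pathPay
  split_ifs <;> first | (exfalso; omega) | norm_num

/-! ### Regret matching with at most two positive regrets -/

/-- The strategy that plays `b₂` with probability `q` and `b₁` with probability `1 - q`. -/
noncomputable def twoMix {n : ℕ} (b₁ b₂ : Fin n) (q : ℝ) : Fin n → ℝ :=
  (1 - q) • Pi.single b₁ 1 + q • Pi.single b₂ 1

lemma twoMix_zero {n : ℕ} (b₁ b₂ : Fin n) : twoMix b₁ b₂ 0 = Pi.single b₁ 1 := by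
  simp [twoMix]

lemma mulVec_twoMix {n : ℕ} (M : Matrix (Fin n) (Fin n) ℝ) (b₁ b₂ : Fin n) (q : ℝ) (a : Fin n) :
    (M *ᵥ twoMix b₁ b₂ q) a = (1 - q) * M a b₁ + q * M a b₂ := by
  simp [twoMix, Matrix.mulVec_add, Matrix.mulVec_smul]

lemma twoMix_dotProduct {n : ℕ} (b₁ b₂ : Fin n) (q : ℝ) (u : Fin n → ℝ) :
    twoMix b₁ b₂ q ⬝ᵥ u = (1 - q) * u b₁ + q * u b₂ := by
  simp [twoMix, add_dotProduct, smul_dotProduct]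

lemma regretUpdate_twoMix {n : ℕ} (r u : Fin n → ℝ) (b₁ b₂ : Fin n) (q : ℝ) (a : Fin n) :
    regretUpdate r (twoMix b₁ b₂ q) u a = r a + u a - ((1 - q) * u b₁ + q * u b₂) := by
  rw [regretUpdate, twoMix_dotProduct]

/-- The probability that regret matching gives to the second of two actions with regrets
`a > 0` and `c`, when all others have nonpositive regret. -/
noncomputable def mixWeight (a c : ℝ) : ℝ := max c 0 / (a + max c 0)

lemma mixWeight_nonneg {a : ℝ} (ha : 0 < a) (c : ℝ) : 0 ≤ mixWeight a c := by
  unfold mixWeight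
  positivity

lemma mixWeight_lt_one {a : ℝ} (ha : 0 < a) (c : ℝ) : mixWeight a c < 1 := by
  have : 0 ≤ max c 0 := le_max_right _ _
  rw [mixWeight, div_lt_one (by linarith)]
  linarith

lemma mixWeight_of_nonpos {c : ℝ} (a : ℝ) (hc : c ≤ 0) : mixWeight a c = 0 := by
  simp [mixWeight, max_eq_right hc]

lemma rmStrategy_eq_twoMix {n : ℕ} {r : Fin n → ℝ} (x : Fin n → ℝ) {b₁ b₂ : Fin n}
    (hne : b₁ ≠ b₂) (hpos : 0 < r b₁) (hnp : ∀ b, b ≠ b₁ → b ≠ b₂ → r b ≤ 0) :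
    rmStrategy r x = twoMix b₁ b₂ (mixWeight (r b₁) (r b₂)) := by
  have hsum : ∑ b, max (r b) 0 = r b₁ + max (r b₂) 0 := by
    rw [Fintype.sum_eq_add b₁ b₂ hne (fun b hb => max_eq_right (hnp b hb.1 hb.2)),
      max_eq_left hpos.le]
  have h2 : 0 ≤ max (r b₂) 0 := le_max_right _ _
  have hd : r b₁ + max (r b₂) 0 ≠ 0 := by linarith
  unfold rmStrategy
  rw [if_neg (fun h => absurd (h b₁) (not_le.2 hpos)), hsum]
  funext a
  by_cases ha1 : a = b₁
  · subst ha1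
    simp only [twoMix, mixWeight, Pi.add_apply, Pi.smul_apply, Pi.single_eq_same,
      Pi.single_eq_of_ne hne, smul_eq_mul, max_eq_left hpos.le]
    field_simp
    ring
  · by_cases ha2 : a = b₂
    · subst ha2
      simp [twoMix, mixWeight, Pi.single_eq_of_ne ha1]
    · simp [twoMix, Pi.single_eq_of_ne ha1, Pi.single_eq_of_ne ha2, hnp a ha1 ha2]

lemma rmStrategy_eq_single {n : ℕ} {r : Fin n → ℝ} (x : Fin n → ℝ) {b : Fin n}
    (hpos : 0 < r b) (hnp : ∀ a, a ≠ b → r a ≤ 0) : rmStrategy r x = Pi.single b 1 := by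
  have hsum : ∑ a, max (r a) 0 = r b := by
    rw [Fintype.sum_eq_single b (fun a ha => max_eq_right (hnp a ha)), max_eq_left hpos.le]
  unfold rmStrategy
  rw [if_neg (fun h => absurd (h b) (not_le.2 hpos)), hsum]
  funext a
  by_cases ha : a = b
  · subst ha
    simp [max_eq_left hpos.le, hpos.ne']
  · simp [Pi.single_eq_of_ne ha, hnp a ha]

lemma regretUpdate_single_self {n : ℕ} (r u : Fin n → ℝ) (a : Fin n) :
    regretUpdate r (Pi.single a 1) u a = r a := by
  rw [regretUpdate, single_one_dotProduct, add_sub_cancel_right]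

/-! ### Path games and the change of regrets in one round -/

/-- A game whose payoffs depend on labels of the actions through `pathPay`: the row player owns
the positions of the parity of `e`, the column player the others, and `act k` is the action at
position `k`. -/
structure IsPathGame {n : ℕ} (m e : ℕ) (M : Matrix (Fin n) (Fin n) ℝ) (labP labQ : Fin n → ℕ)
    (act : ℕ → Fin n) : Prop where
  pay : ∀ a b, M a b = pathPay m (labP a) (labQ b)
  injP : Function.Injective labP
  injQ : Function.Injective labQ
  actP : ∀ k, k ≤ 2 * m → (k + e) % 2 = 0 → labP (act k) = k
  actQ : ∀ k, k ≤ 2 * m → (k + e) % 2 = 1 → labQ (act k) = k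

namespace IsPathGame

variable {n m e : ℕ} {M : Matrix (Fin n) (Fin n) ℝ} {labP labQ : Fin n → ℕ} {act : ℕ → Fin n}

/-- Exchanging the players flips the parity of the owned positions, so every statement about the row
player also serves the column player. -/
lemma transpose (G : IsPathGame m e M labP labQ act) :
    IsPathGame m (e + 1) Mᵀ labQ labP act where
  pay a b := by rw [Matrix.transpose_apply, G.pay, pathPay_comm]
  injP := G.injQ
  injQ := G.injP
  actP k h1 h2 := G.actQ k h1 (by omega)
  actQ k h1 h2 := G.actP k h1 (by omega)

lemma act_ne (G : IsPathGame m e M labP labQ act) {i j : ℕ} (hi : i ≤ 2 * m) (hj : j ≤ 2 * m)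
    (hij : i ≠ j) (hp : (i + j) % 2 = 0) : act i ≠ act j := by
  intro h
  rcases Nat.mod_two_eq_zero_or_one (i + e) with h0 | h0
  · exact hij (by rw [← G.actP i hi h0, h, G.actP j hj (by omega)])
  · exact hij (by rw [← G.actQ i hi h0, h, G.actQ j hj (by omega)])

section Pure

variable (G : IsPathGame m e M labP labQ act) {k : ℕ} (hk : 2 ≤ k) (hkm : k + 1 ≤ 2 * m)
  (he : (k + e) % 2 = 0) {q : ℝ}
include G hk hkm he

lemma payoff_pure : (M *ᵥ twoMix (act (k + 1)) (act (k - 1)) q) (act k) = k - q := by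
  rw [mulVec_twoMix, G.pay, G.pay, G.actP k (by omega) he, G.actQ (k + 1) hkm (by omega),
    G.actQ (k - 1) (by omega) (by omega), pathPay_succ (by omega) hkm,
    pathPay_pred hk (by omega)]
  ring

lemma regret_pure_eq (r : Fin n → ℝ) (a : Fin n) :
    regretUpdate r (Pi.single (act k) 1) (M *ᵥ twoMix (act (k + 1)) (act (k - 1)) q) a =
      r a + ((1 - q) * pathPay m (labP a) (k + 1) + q * pathPay m (labP a) (k - 1)) - (k - q) := by
  rw [regretUpdate, single_one_dotProduct, G.payoff_pure hk hkm he, mulVec_twoMix, G.pay, G.pay,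
    G.actQ (k + 1) hkm (by omega), G.actQ (k - 1) (by omega) (by omega)]

lemma regret_pure_next (hkm2 : k + 2 ≤ 2 * m) (r : Fin n → ℝ) :
    regretUpdate r (Pi.single (act k) 1) (M *ᵥ twoMix (act (k + 1)) (act (k - 1)) q)
      (act (k + 2)) = r (act (k + 2)) + 1 - k * q := by
  rw [G.regret_pure_eq hk hkm he, G.actP (k + 2) hkm2 (by omega),
    pathPay_eq_zero (j := k - 1) (by omega) (by omega), pathPay_comm,
    pathPay_succ (by omega) hkm2]
  push_cast
  ring

lemma regret_pure_far_eq (r : Fin n → ℝ) {a : Fin n} (ha : k + 3 ≤ labP a) :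
    regretUpdate r (Pi.single (act k) 1) (M *ᵥ twoMix (act (k + 1)) (act (k - 1)) q) a =
      r a - (k - q) := by
  rw [G.regret_pure_eq hk hkm he, pathPay_eq_zero (by omega) (by omega),
    pathPay_eq_zero (by omega) (by omega)]
  ring

lemma regret_pure_far (hq1 : q ≤ 1) (r : Fin n → ℝ) {a : Fin n} (ha : k + 3 ≤ labP a) :
    regretUpdate r (Pi.single (act k) 1) (M *ᵥ twoMix (act (k + 1)) (act (k - 1)) q) a ≤
      r a - (k - 1) := by
  rw [G.regret_pure_far_eq hk hkm he r ha]
  linarith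

variable (hq0 : 0 ≤ q) (hq1 : q ≤ 1)
include hq0 hq1

lemma regret_pure_next_le (r : Fin n → ℝ) {a : Fin n} (ha : labP a = k + 2) :
    regretUpdate r (Pi.single (act k) 1) (M *ᵥ twoMix (act (k + 1)) (act (k - 1)) q) a ≤
      r a + 1 := by
  rw [G.regret_pure_eq hk hkm he, ha, pathPay_eq_zero (j := k - 1) (by omega) (by omega)]
  have h := pathPay_succ_le m (k + 1) (by omega)
  have h' := mul_le_mul_of_nonneg_left h (sub_nonneg.2 hq1)
  push_cast at h'
  have : 0 ≤ (k : ℝ) * q := by positivity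
  linarith

/-- Against k+1 only k and k+2 can pay more than 1/2; against k-1 only k and k-2 can, the latter at
most k-1. So such an action earns at most (1-q)k + q(k-1) = k - q, the realized payoff. -/
lemma regret_pure_le (r : Fin n → ℝ) {a : Fin n} (ha : a ≠ act k) (ha' : labP a ≠ k + 2) :
    regretUpdate r (Pi.single (act k) 1) (M *ᵥ twoMix (act (k + 1)) (act (k - 1)) q) a ≤ r a := by
  have hl : labP a ≠ k := fun h => ha (G.injP (by rw [h, G.actP k (by omega) he]))
  have hk' : (2 : ℝ) ≤ k := by exact_mod_cast hk
  have h1 : pathPay m (labP a) (k + 1) ≤ k := by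
    refine (pathPay_le_half (by omega) (by omega)).trans ?_
    linarith
  have h2 : pathPay m (labP a) (k - 1) ≤ k - 1 := by
    by_cases h0 : k - 1 = labP a + 1 ∧ labP a ≠ 0
    · have := pathPay_succ_le m (labP a) (by omega)
      rw [pathPay_comm, h0.1]
      refine this.trans ?_
      have : ((labP a + 2 : ℕ) : ℝ) = k := by congr 1; omega
      push_cast at this
      linarith
    · refine (pathPay_le_half (by omega) (by omega)).trans ?_
      linarith
  rw [G.regret_pure_eq hk hkm he]
  have h1' := mul_le_mul_of_nonneg_left h1 (sub_nonneg.2 hq1)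
  have h2' := mul_le_mul_of_nonneg_left h2 hq0
  linarith

end Pure

section Mixed

variable (G : IsPathGame m e M labP labQ act) {k : ℕ} (hk : 2 ≤ k) (hkm : k + 1 ≤ 2 * m)
  (he : (k + e) % 2 = 1) {q : ℝ}
include G hk hkm he

lemma regret_mixed_eq (r : Fin n → ℝ) (a : Fin n) :
    regretUpdate r (twoMix (act (k + 1)) (act (k - 1)) q) (M *ᵥ Pi.single (act k) 1) a =
      r a + pathPay m (labP a) k - (k - q) := by
  rw [regretUpdate_twoMix]
  simp only [mulVec_single_one, Matrix.col_apply]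
  rw [G.pay, G.pay, G.pay, G.actQ k (by omega) he, G.actP (k + 1) hkm (by omega),
    G.actP (k - 1) (by omega) (by omega), pathPay_comm m (k + 1), pathPay_succ (by omega) hkm,
    pathPay_comm m (k - 1), pathPay_pred hk (by omega)]
  ring

lemma regret_mixed_new (r : Fin n → ℝ) :
    regretUpdate r (twoMix (act (k + 1)) (act (k - 1)) q) (M *ᵥ Pi.single (act k) 1)
      (act (k + 1)) = r (act (k + 1)) + q := by
  rw [G.regret_mixed_eq hk hkm he, G.actP (k + 1) hkm (by omega), pathPay_comm,
    pathPay_succ (by omega) hkm]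
  ring

lemma regret_mixed_old (r : Fin n → ℝ) :
    regretUpdate r (twoMix (act (k + 1)) (act (k - 1)) q) (M *ᵥ Pi.single (act k) 1)
      (act (k - 1)) = r (act (k - 1)) - (1 - q) := by
  rw [G.regret_mixed_eq hk hkm he, G.actP (k - 1) (by omega) (by omega), pathPay_comm,
    pathPay_pred hk (by omega)]
  ring

lemma regret_mixed_far_eq (r : Fin n → ℝ) {a : Fin n} (ha : k + 2 ≤ labP a) :
    regretUpdate r (twoMix (act (k + 1)) (act (k - 1)) q) (M *ᵥ Pi.single (act k) 1) a =
      r a - (k - q) := by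
  rw [G.regret_mixed_eq hk hkm he, pathPay_eq_zero (by omega) (by omega)]
  ring

variable (hq1 : q ≤ 1)
include hq1

lemma regret_mixed_far (r : Fin n → ℝ) {a : Fin n} (ha : k + 3 ≤ labP a) :
    regretUpdate r (twoMix (act (k + 1)) (act (k - 1)) q) (M *ᵥ Pi.single (act k) 1) a ≤
      r a - (k - 1) := by
  rw [G.regret_mixed_far_eq hk hkm he r (by omega)]
  linarith

lemma regret_mixed_le (r : Fin n → ℝ) {a : Fin n} (ha : a ≠ act (k + 1)) (ha' : a ≠ act (k - 1)) :
    regretUpdate r (twoMix (act (k + 1)) (act (k - 1)) q) (M *ᵥ Pi.single (act k) 1) a ≤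
      r a := by
  have hl : labP a ≠ k + 1 := fun h => ha (G.injP (by rw [h, G.actP (k + 1) hkm (by omega)]))
  have hl' : labP a ≠ k - 1 :=
    fun h => ha' (G.injP (by rw [h, G.actP (k - 1) (by omega) (by omega)]))
  have hk' : (2 : ℝ) ≤ k := by exact_mod_cast hk
  have := pathPay_le_half (m := m) (i := labP a) (j := k) (by omega) (by omega)
  rw [G.regret_mixed_eq hk hkm he]
  linarith

end Mixed

end IsPathGame

/-! ### Regret matching between two actions whose payoffs differ by one -/

/-- Regrets of two actions, the second paying one less than the first, under regret matching. -/
noncomputable def mixSeq (a c : ℝ) : ℕ → ℝ × ℝ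
  | 0 => (a, c)
  | i + 1 => ((mixSeq a c i).1 + mixWeight (mixSeq a c i).1 (mixSeq a c i).2,
      (mixSeq a c i).2 - (1 - mixWeight (mixSeq a c i).1 (mixSeq a c i).2))

section MixSeq

variable {a c : ℝ} (ha : 0 < a)
include ha

lemma mixSeq_pos (i : ℕ) : 0 < (mixSeq a c i).1 := by
  induction i with
  | zero => exact ha
  | succ i ih =>
    have := mixWeight_nonneg ih (mixSeq a c i).2
    simp only [mixSeq]
    linarith

lemma mixSeq_fst_mono : Monotone fun i => (mixSeq a c i).1 :=
  monotone_nat_of_le_succ fun i => by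
    have := mixWeight_nonneg (mixSeq_pos (c := c) ha i) (mixSeq a c i).2
    simp only [mixSeq]
    linarith

lemma mixSeq_snd_anti : Antitone fun i => (mixSeq a c i).2 :=
  antitone_nat_of_succ_le fun i => by
    have := mixWeight_lt_one (mixSeq_pos (c := c) ha i) (mixSeq a c i).2
    simp only [mixSeq]
    linarith

/-- While the second regret exceeds the first, the second action has weight at least 1/2, so the
first regret gains at least 1/2 per round. -/
lemma mixSeq_catch_up (i : ℕ) :
    (mixSeq a c i).2 ≤ (mixSeq a c i).1 ∨ (i : ℝ) / 2 ≤ (mixSeq a c i).1 := by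
  induction i with
  | zero => right; simpa [mixSeq] using ha.le
  | succ i ih =>
    by_cases h : (mixSeq a c i).2 ≤ (mixSeq a c i).1
    · left
      exact ((mixSeq_snd_anti ha i.le_succ).trans h).trans (mixSeq_fst_mono ha i.le_succ)
    · right
      have h1 := ih.resolve_left h
      have hp := mixSeq_pos (c := c) ha i
      push Not at h
      have : 1 / 2 ≤ mixWeight (mixSeq a c i).1 (mixSeq a c i).2 := by
        rw [mixWeight, max_eq_left (by linarith), div_le_div_iff₀ (by norm_num) (by linarith)]
        linarith
      simp only [mixSeq]
      push_cast
      linarith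

/-- After N rounds the first regret has caught up. From then on the second action has weight at most
1/2, so its regret loses at least 1/2 per round while positive, and N more rounds use up N/2. -/
lemma mixSeq_snd_nonpos {N : ℕ} (hc : c ≤ N / 2) : (mixSeq a c (2 * N)).2 ≤ 0 := by
  have h0 : (mixSeq a c N).2 ≤ (mixSeq a c N).1 := by
    rcases mixSeq_catch_up (c := c) ha N with h | h
    · exact h
    · exact ((mixSeq_snd_anti ha N.zero_le).trans hc).trans h
  have key : ∀ j : ℕ, (mixSeq a c (N + j)).2 ≤ 0 ∨
      (mixSeq a c (N + j)).2 ≤ ((N : ℝ) - j) / 2 := by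
    intro j
    induction j with
    | zero =>
      right
      have : (mixSeq a c N).2 ≤ c := mixSeq_snd_anti ha N.zero_le
      simpa using this.trans hc
    | succ j ih =>
      by_cases h : (mixSeq a c (N + j)).2 ≤ 0
      · exact Or.inl ((mixSeq_snd_anti ha (N + j).le_succ).trans h)
      · right
        have h1 := ih.resolve_left h
        push Not at h
        have hle : (mixSeq a c (N + j)).2 ≤ (mixSeq a c (N + j)).1 :=
          ((mixSeq_snd_anti ha (N.le_add_right j)).trans h0).trans
            (mixSeq_fst_mono ha (N.le_add_right j))
        have : mixWeight (mixSeq a c (N + j)).1 (mixSeq a c (N + j)).2 ≤ 1 / 2 := by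
          rw [mixWeight, max_eq_left h.le, div_le_div_iff₀ (by linarith) (by norm_num)]
          linarith
        rw [← add_assoc]
        simp only [mixSeq]
        push_cast
        linarith
  have := key N
  rw [← two_mul, sub_self, zero_div] at this
  exact this.elim id id

/-- Blackwell's argument: while both regrets are positive, the increment (q, -(1-q)) is orthogonal
to the regret vector, so the squared norm grows by at most q² + (1-q)² ≤ 1. -/
lemma mixSeq_potential (i : ℕ) :
    (mixSeq a c i).1 ^ 2 + max (mixSeq a c i).2 0 ^ 2 ≤ a ^ 2 + max c 0 ^ 2 + i := by
  induction i with
  | zero => simp [mixSeq]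
  | succ i ih =>
    have hp := mixSeq_pos (c := c) ha i
    set A := (mixSeq a c i).1 with hA
    set C := (mixSeq a c i).2 with hC
    have hq0 := mixWeight_nonneg hp C
    have hq1 := mixWeight_lt_one hp C
    have hstep : mixSeq a c (i + 1) = (A + mixWeight A C, C - (1 - mixWeight A C)) := rfl
    rw [hstep]
    push_cast
    by_cases h : C ≤ 0
    · rw [mixWeight_of_nonpos A h, max_eq_right (by linarith)]
      rw [max_eq_right h] at ih
      linarith
    · push Not at h
      -- This is the orthogonality qA = (1-q)C.
      have hw : mixWeight A C * (A + C) = C := by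
        rw [mixWeight, max_eq_left h.le]
        field_simp
      have hm : max (C - (1 - mixWeight A C)) 0 ^ 2 ≤ (C - (1 - mixWeight A C)) ^ 2 := by
        rcases le_total (C - (1 - mixWeight A C)) 0 with h' | h'
        · rw [max_eq_right h']; simpa using sq_nonneg _
        · rw [max_eq_left h']
      rw [max_eq_left h.le] at ih
      show (A + mixWeight A C) ^ 2 + max (C - (1 - mixWeight A C)) 0 ^ 2 ≤ _
      nlinarith

/-- At round 2N the potential is at most 1 + N²/4 + 2N < (N/2 + 2)². Afterwards the second action
has weight 0 and the first regret is frozen. -/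
lemma mixSeq_fst_le {N : ℕ} (ha1 : a ≤ 1) (hc : c ≤ N / 2) (i : ℕ) :
    (mixSeq a c i).1 ≤ N / 2 + 2 := by
  have h2N : (mixSeq a c (2 * N)).1 ≤ N / 2 + 2 := by
    have h := mixSeq_potential (c := c) ha (2 * N)
    have hm : max c 0 ^ 2 ≤ ((N : ℝ) / 2) ^ 2 := by
      gcongr
      exact max_le hc (by positivity)
    have := mixSeq_pos (c := c) ha (2 * N)
    push_cast at h
    refine le_of_sq_le_sq ?_ (by positivity)
    nlinarith [sq_nonneg (max (mixSeq a c (2 * N)).2 0)]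
  rcases le_total i (2 * N) with h | h
  · exact (mixSeq_fst_mono ha h).trans h2N
  · induction i, h using Nat.le_induction with
    | base => exact h2N
    | succ i hi ih =>
      have : (mixSeq a c i).2 ≤ 0 := (mixSeq_snd_anti ha hi).trans (mixSeq_snd_nonpos ha hc)
      simp only [mixSeq, mixWeight_of_nonpos _ this]
      linarith

end MixSeq

/-! ### Phases of the dynamics -/

/-- Regret matching by two players in a path game. The utility vector that a player observes in
round `t` comes from the other player's strategy after round `t + δ`. -/
structure IsPathDynamics {n : ℕ} (m e : ℕ) (M : Matrix (Fin n) (Fin n) ℝ) (labP labQ : Fin n → ℕ)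
    (act : ℕ → Fin n) (δP δQ : ℕ) (rP xP rQ xQ : ℕ → Fin n → ℝ) : Prop where
  game : IsPathGame m e M labP labQ act
  delay : δP = 0 ∧ δQ = 0 ∨ δP = 0 ∧ δQ = 1 ∨ δP = 1 ∧ δQ = 0
  rP_succ : ∀ t, rP (t + 1) = regretUpdate (rP t) (xP t) (M *ᵥ xQ (t + δP))
  xP_succ : ∀ t, xP (t + 1) = rmStrategy (rP (t + 1)) (xP t)
  rQ_succ : ∀ t, rQ (t + 1) = regretUpdate (rQ t) (xQ t) (Mᵀ *ᵥ xP (t + δQ))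
  xQ_succ : ∀ t, xQ (t + 1) = rmStrategy (rQ (t + 1)) (xQ t)

/-- The situation in which the players play the profile at positions `k` and `k + 1` for the first
time. The owner of position `k` plays it purely, and the regret of the action at position `k + 2`
is at most `-E`. The other player mixes the actions at positions `k + 1` and `k - 1`. -/
structure PhaseStart {n : ℕ} (k : ℕ) (E : ℝ) (labP labQ : Fin n → ℕ)
    (act : ℕ → Fin n) (rP xP rQ xQ : Fin n → ℝ) : Prop where
  xP_eq : xP = Pi.single (act k) 1
  rP_pos : 0 < rP (act k)
  rP_le : rP (act k) ≤ k - 3 / 2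
  rP_nonpos : ∀ a, a ≠ act k → rP a ≤ 0
  rP_next : ∀ a, labP a = k + 2 → rP a ≤ -E
  rP_far : ∀ a, k + 3 ≤ labP a → rP a ≤ -(4 * k - 10)
  xQ_eq : xQ = twoMix (act (k + 1)) (act (k - 1)) (mixWeight (rQ (act (k + 1))) (rQ (act (k - 1))))
  rQ_pos : 0 < rQ (act (k + 1))
  rQ_le : rQ (act (k + 1)) ≤ 1
  rQ_old : rQ (act (k - 1)) ≤ k - 5 / 2
  rQ_nonpos : ∀ b, b ≠ act (k + 1) → b ≠ act (k - 1) → rQ b ≤ 0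
  rQ_far : ∀ b, k + 3 ≤ labQ b → rQ b ≤ -(4 * k - 8)

/-- Puts k - 5/2 in the form N/2 with N = 2k-5; the settling time is then 2N = 4k-10. -/
lemma PhaseStart.rQ_old_le_half {n k : ℕ} {E : ℝ} {labP labQ : Fin n → ℕ} {act : ℕ → Fin n}
    {rP xP rQ xQ : Fin n → ℝ} (h : PhaseStart k E labP labQ act rP xP rQ xQ) (hk : 3 ≤ k) :
    rQ (act (k - 1)) ≤ (2 * k - 5 : ℕ) / 2 := by
  have := h.rQ_old
  rw [Nat.cast_sub (by omega)]
  push_cast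
  linarith

lemma PhaseStart.mixSeq_snd_nonpos {n k : ℕ} {E : ℝ} {labP labQ : Fin n → ℕ} {act : ℕ → Fin n}
    {rP xP rQ xQ : Fin n → ℝ} (h : PhaseStart k E labP labQ act rP xP rQ xQ) (hk : 3 ≤ k) {i : ℕ}
    (hi : 4 * k - 10 ≤ i) : (mixSeq (rQ (act (k + 1))) (rQ (act (k - 1))) i).2 ≤ 0 :=
  (mixSeq_snd_anti h.rQ_pos (by omega)).trans
    (_root_.mixSeq_snd_nonpos h.rQ_pos (h.rQ_old_le_half hk))

/-- The strategies between the first play at positions `k`, `k + 1` and the first play at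
positions `k + 1`, `k + 2`. -/
def InPhase {n : ℕ} (k : ℕ) (act : ℕ → Fin n) (xP xQ : Fin n → ℝ) : Prop :=
  xP = Pi.single (act k) 1 ∧
    ∃ q : ℝ, 0 ≤ q ∧ q < 1 ∧ (2 ≤ k ∨ q = 0) ∧ xQ = twoMix (act (k + 1)) (act (k - 1)) q

/-- The owner of position `k`, `t` rounds into the phase. -/
structure PureRun {n : ℕ} (k : ℕ) (E : ℝ) (labP : Fin n → ℕ) (act : ℕ → Fin n) (r₀ : ℝ) (t : ℕ)
    (r x : Fin n → ℝ) : Prop where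
  x_eq : x = Pi.single (act k) 1
  r_act : r (act k) = r₀
  nonpos : ∀ a, a ≠ act k → r a ≤ 0
  next : ∀ a, labP a = k + 2 → r a ≤ -E + t
  far : ∀ a, k + 3 ≤ labP a → r a ≤ -(4 * k - 10) - (k - 1) * t

/-- The other player, `t` rounds into the phase. -/
structure MixedRun {n : ℕ} (k : ℕ) (labQ : Fin n → ℕ) (act : ℕ → Fin n) (a c : ℝ) (t : ℕ)
    (r x : Fin n → ℝ) : Prop where
  r_new : r (act (k + 1)) = (mixSeq a c t).1
  r_old : r (act (k - 1)) = (mixSeq a c t).2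
  x_eq : x = twoMix (act (k + 1)) (act (k - 1)) (mixWeight (mixSeq a c t).1 (mixSeq a c t).2)
  nonpos : ∀ b, b ≠ act (k + 1) → b ≠ act (k - 1) → r b ≤ 0
  far : ∀ b, k + 3 ≤ labQ b → r b ≤ -(4 * k - 8) - (k - 1) * t

namespace IsPathGame

variable {n m e : ℕ} {M : Matrix (Fin n) (Fin n) ℝ} {labP labQ : Fin n → ℕ} {act : ℕ → Fin n}

/-- Regrets after a round of a player who plays position `k` purely against a mixture of the
positions `k + 1` and `k - 1`. -/
lemma pureRun_regret (G : IsPathGame m e M labP labQ act) {k : ℕ} (hk : 2 ≤ k)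
    (hkm : k + 2 ≤ 2 * m) (he : (k + e) % 2 = 0) {E r₀ : ℝ} {t : ℕ} {r x : Fin n → ℝ}
    (h : PureRun k E labP act r₀ t r x) {q : ℝ} (hq0 : 0 ≤ q) (hq1 : q ≤ 1) {r' : Fin n → ℝ}
    (hr' : r' = regretUpdate r x (M *ᵥ twoMix (act (k + 1)) (act (k - 1)) q)) :
    r' (act k) = r₀ ∧ r' (act (k + 2)) = r (act (k + 2)) + 1 - k * q ∧
      (∀ a, a ≠ act k → a ≠ act (k + 2) → r' a ≤ 0) ∧
      (∀ a, labP a = k + 2 → r' a ≤ -E + (t + 1 : ℕ)) ∧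
      (∀ a, k + 3 ≤ labP a → r' a ≤ -(4 * k - 10) - (k - 1) * (t + 1 : ℕ)) := by
  subst hr'
  rw [h.x_eq]
  refine ⟨by rw [regretUpdate_single_self, h.r_act],
    G.regret_pure_next hk (by omega) he hkm r, fun a ha ha' => ?_, fun a ha => ?_, fun a ha => ?_⟩
  · refine (G.regret_pure_le hk (by omega) he hq0 hq1 r ha fun hl => ha' ?_).trans (h.nonpos a ha)
    exact G.injP (by rw [hl, G.actP (k + 2) hkm (by omega)])
  · have := G.regret_pure_next_le hk (by omega) he hq0 hq1 r ha
    have := h.next a ha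
    push_cast
    linarith
  · have := G.regret_pure_far hk (by omega) he hq1 r ha
    have := h.far a ha
    push_cast
    linarith

lemma pureRun_succ (G : IsPathGame m e M labP labQ act) {k : ℕ} (hk : 2 ≤ k)
    (hkm : k + 2 ≤ 2 * m) (he : (k + e) % 2 = 0) {E r₀ : ℝ} {t : ℕ} {r x : Fin n → ℝ}
    (h : PureRun k E labP act r₀ t r x) (hr₀ : 0 < r₀) {q : ℝ} (hq0 : 0 ≤ q) (hq1 : q ≤ 1)
    {r' x' : Fin n → ℝ}
    (hr' : r' = regretUpdate r x (M *ᵥ twoMix (act (k + 1)) (act (k - 1)) q))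
    (hx' : x' = rmStrategy r' x) (hnext : r' (act (k + 2)) ≤ 0) :
    PureRun k E labP act r₀ (t + 1) r' x' := by
  obtain ⟨h1, -, h3, h4, h5⟩ := G.pureRun_regret hk hkm he h hq0 hq1 hr'
  have hnp : ∀ a, a ≠ act k → r' a ≤ 0 := by
    intro a ha
    by_cases ha' : a = act (k + 2)
    · rwa [ha']
    · exact h3 a ha ha'
  exact ⟨hx'.trans (rmStrategy_eq_single x (by rwa [h1]) hnp), h1, hnp, h4, h5⟩

lemma mixedRun_succ (G : IsPathGame m e M labP labQ act) {k : ℕ} (hk : 2 ≤ k)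
    (hkm : k + 1 ≤ 2 * m) (he : (k + e) % 2 = 1) {a c : ℝ} (ha : 0 < a) {t : ℕ}
    {r x : Fin n → ℝ} (h : MixedRun k labP act a c t r x)
    {r' x' : Fin n → ℝ} (hr' : r' = regretUpdate r x (M *ᵥ Pi.single (act k) 1))
    (hx' : x' = rmStrategy r' x) : MixedRun k labP act a c (t + 1) r' x' := by
  have hpos := mixSeq_pos (c := c) ha t
  have hq1 := (mixWeight_lt_one hpos (mixSeq a c t).2).le
  have hne : act (k + 1) ≠ act (k - 1) := G.act_ne hkm (by omega) (by omega) (by omega)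
  have h1 : r' (act (k + 1)) = (mixSeq a c (t + 1)).1 := by
    rw [hr', h.x_eq, G.regret_mixed_new hk hkm he, h.r_new]
    rfl
  have h2 : r' (act (k - 1)) = (mixSeq a c (t + 1)).2 := by
    rw [hr', h.x_eq, G.regret_mixed_old hk hkm he, h.r_old]
    rfl
  have h3 : ∀ b, b ≠ act (k + 1) → b ≠ act (k - 1) → r' b ≤ 0 := by
    intro b hb hb'
    rw [hr', h.x_eq]
    exact (G.regret_mixed_le hk hkm he hq1 r hb hb').trans (h.nonpos b hb hb')
  refine ⟨h1, h2, ?_, h3, fun b hb => ?_⟩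
  · rw [hx', rmStrategy_eq_twoMix x hne (by rw [h1]; exact mixSeq_pos ha _) h3, h1, h2]
  · have := h.far b hb
    rw [hr', h.x_eq]
    have := G.regret_mixed_far hk hkm he hq1 r hb
    push_cast
    linarith

end IsPathGame

namespace IsPathDynamics

variable {n m e : ℕ} {M : Matrix (Fin n) (Fin n) ℝ} {labP labQ : Fin n → ℕ} {act : ℕ → Fin n}
  {δP δQ : ℕ} {rP xP rQ xQ : ℕ → Fin n → ℝ}

/-- Ownership alternates from phase to phase, so the roles must be exchangeable; this is why a delay
of the first player is admitted too. -/
lemma swap (D : IsPathDynamics m e M labP labQ act δP δQ rP xP rQ xQ) :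
    IsPathDynamics m (e + 1) Mᵀ labQ labP act δQ δP rQ xQ rP xP where
  game := D.game.transpose
  delay := by have := D.delay; omega
  rP_succ := D.rQ_succ
  xP_succ := D.xQ_succ
  rQ_succ := by rw [Matrix.transpose_transpose]; exact D.rP_succ
  xQ_succ := D.xP_succ

section Phase

variable (D : IsPathDynamics m e M labP labQ act δP δQ rP xP rQ xQ) {k : ℕ} (hk : 3 ≤ k)
  (hkm : k + 2 ≤ 2 * m) (he : (k + e) % 2 = 0) {E : ℝ} {s : ℕ}
  (h : PhaseStart k E labP labQ act (rP s) (xP s) (rQ s) (xQ s))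
include D hk hkm he h

/-- One round inside the phase, up to the regrets of the first player. -/
lemma exists_regret_step {t : ℕ}
    (hP : PureRun k E labP act (rP s (act k)) t (rP (s + t)) (xP (s + t)))
    (hQ : MixedRun k labQ act (rQ s (act (k + 1))) (rQ s (act (k - 1))) t
      (rQ (s + t)) (xQ (s + t))) :
    ∃ i, t ≤ i ∧ rP (s + (t + 1)) = regretUpdate (rP (s + t)) (xP (s + t))
      (M *ᵥ twoMix (act (k + 1)) (act (k - 1))
        (mixWeight (mixSeq (rQ s (act (k + 1))) (rQ s (act (k - 1))) i).1
          (mixSeq (rQ s (act (k + 1))) (rQ s (act (k - 1))) i).2)) := by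
  have hr := D.rP_succ (s + t)
  rcases D.delay with ⟨h1, -⟩ | ⟨h1, -⟩ | ⟨h1, h2⟩
  · exact ⟨t, le_rfl, by rw [← hQ.x_eq]; simpa [h1, add_assoc] using hr⟩
  · exact ⟨t, le_rfl, by rw [← hQ.x_eq]; simpa [h1, add_assoc] using hr⟩
  -- Here the first player observes the opponent's new strategy. The opponent's update uses only the
  -- old strategy, so it can be carried out beforehand.
  · have hQ' : MixedRun k labQ act (rQ s (act (k + 1))) (rQ s (act (k - 1))) (t + 1)
        (rQ (s + (t + 1))) (xQ (s + (t + 1))) := by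
      refine D.game.transpose.mixedRun_succ (by omega) (by omega) (by omega) h.rQ_pos hQ ?_
        (D.xQ_succ _)
      have := D.rQ_succ (s + t)
      rwa [h2, add_zero, hP.x_eq] at this
    refine ⟨t + 1, t.le_succ, ?_⟩
    rw [← hQ'.x_eq]
    simpa [h1, add_assoc] using hr

/-- As long as k+2 has no positive regret, the owner of k has no alternative to k. The opponent then
faces a fixed pure strategy, and its two relevant regrets follow `mixSeq` exactly. -/
lemma run (t : ℕ) (hnext : ∀ i ≤ t, rP (s + i) (act (k + 2)) ≤ 0) :
    PureRun k E labP act (rP s (act k)) t (rP (s + t)) (xP (s + t)) ∧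
      MixedRun k labQ act (rQ s (act (k + 1))) (rQ s (act (k - 1))) t
        (rQ (s + t)) (xQ (s + t)) := by
  induction t with
  | zero =>
    refine ⟨⟨h.xP_eq, rfl, h.rP_nonpos, fun a ha => ?_, fun a ha => ?_⟩,
      ⟨rfl, rfl, h.xQ_eq, h.rQ_nonpos, fun b hb => ?_⟩⟩
    · simpa using h.rP_next a ha
    · simpa using h.rP_far a ha
    · simpa using h.rQ_far b hb
  | succ t ih =>
    obtain ⟨hP, hQ⟩ := ih fun i hi => hnext i (by omega)
    obtain ⟨i, -, hr⟩ := D.exists_regret_step hk hkm he h hP hQ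
    have hpos := mixSeq_pos (c := rQ s (act (k - 1))) h.rQ_pos i
    have hP' : PureRun k E labP act (rP s (act k)) (t + 1) (rP (s + (t + 1)))
        (xP (s + (t + 1))) :=
      D.game.pureRun_succ (by omega) hkm he hP h.rP_pos (mixWeight_nonneg hpos _)
        (mixWeight_lt_one hpos _).le hr (D.xP_succ _) (hnext (t + 1) le_rfl)
    refine ⟨hP', D.game.transpose.mixedRun_succ (by omega) (by omega) (by omega) h.rQ_pos hQ ?_
      (D.xQ_succ _)⟩
    have hr' := D.rQ_succ (s + t)
    have hx : xP (s + t + δQ) = Pi.single (act k) 1 := by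
      rcases D.delay with ⟨-, h2⟩ | ⟨-, h2⟩ | ⟨-, h2⟩ <;> rw [h2]
      · exact hP.x_eq
      · exact hP'.x_eq
      · exact hP.x_eq
    rwa [hx] at hr'

/-- Otherwise the phase never ends; after 4k-10 rounds q = 0, and the regret of k+2 grows by 1 in
every round. -/
lemma exists_next_pos : ∃ t, 0 < rP (s + t) (act (k + 2)) := by
  by_contra! hcon
  have hgrow : ∀ j : ℕ, rP (s + (4 * k - 10 + j)) (act (k + 2)) =
      rP (s + (4 * k - 10)) (act (k + 2)) + j := by
    intro j
    induction j with
    | zero => simp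
    | succ j ih =>
      obtain ⟨hP, hQ⟩ := D.run hk hkm he h (4 * k - 10 + j) fun i _ => hcon i
      obtain ⟨i, hi, hr⟩ := D.exists_regret_step hk hkm he h hP hQ
      rw [mixWeight_of_nonpos _ (h.mixSeq_snd_nonpos hk (i := i) (by omega))] at hr
      have := (D.game.pureRun_regret (by omega) hkm he hP le_rfl zero_le_one hr).2.1
      rw [← add_assoc (4 * k - 10), this, ih]
      push_cast
      ring
  obtain ⟨j, hj⟩ := exists_nat_gt (-rP (s + (4 * k - 10)) (act (k + 2)))
  have := hcon (4 * k - 10 + j)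
  rw [hgrow] at this
  linarith

/-- The phase ends after more than `E` rounds, and then the next one starts. -/
theorem exists_next_phaseStart (hE : 4 * k - 10 ≤ E) :
    ∃ T : ℕ, E < T ∧ (∀ t < T, InPhase k act (xP (s + t)) (xQ (s + t))) ∧
      PhaseStart (k + 1) ((k - 1) * T + 3 * k - 8) labQ labP act
        (rQ (s + T)) (xQ (s + T)) (rP (s + T)) (xP (s + T)) := by
  classical
  have hk' : (3 : ℝ) ≤ k := by exact_mod_cast hk
  have hex := D.exists_next_pos hk hkm he h
  obtain ⟨T, hT⟩ : ∃ T, Nat.find hex = T := ⟨_, rfl⟩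
  have hTpos : 0 < rP (s + T) (act (k + 2)) := hT ▸ Nat.find_spec hex
  have hTmin : ∀ t < T, rP (s + t) (act (k + 2)) ≤ 0 := fun t ht =>
    not_lt.1 (Nat.find_min hex (by omega))
  have hlab : labP (act (k + 2)) = k + 2 := D.game.actP _ hkm (by omega)
  have hE0 : (2 : ℝ) ≤ E := by linarith
  obtain ⟨t, rfl⟩ : ∃ t, T = t + 1 := by
    refine ⟨T - 1, ?_⟩
    rcases Nat.eq_zero_or_pos T with h0 | h0
    · exfalso
      subst h0
      have := h.rP_next _ hlab
      rw [add_zero] at hTpos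
      linarith
    · omega
  have hrun : ∀ i ≤ t, _ := fun i hi => D.run hk hkm he h i fun j hj => hTmin j (by omega)
  obtain ⟨hP, hQ⟩ := hrun t le_rfl
  obtain ⟨i, -, hr⟩ := D.exists_regret_step hk hkm he h hP hQ
  have hpos := mixSeq_pos (c := rQ s (act (k - 1))) h.rQ_pos i
  have hq0 := mixWeight_nonneg hpos (mixSeq (rQ s (act (k + 1))) (rQ s (act (k - 1))) i).2
  have hq1 := (mixWeight_lt_one hpos (mixSeq (rQ s (act (k + 1))) (rQ s (act (k - 1))) i).2).le
  obtain ⟨hr1, hr2, hr3, hr4, hr5⟩ := D.game.pureRun_regret (by omega) hkm he hP hq0 hq1 hr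
  have hET : E < (t + 1 : ℕ) := by
    have := hr4 _ hlab
    linarith
  -- The phase outlasts the settling time, so the opponent is already pure one round before its end.
  have ht : 4 * k - 10 ≤ t := by
    have : (4 * k : ℝ) < ((t + 11 : ℕ) : ℝ) := by push_cast at hET ⊢; linarith
    have : 4 * k < t + 11 := by exact_mod_cast this
    omega
  have hkt : (4 : ℝ) * k - 10 ≤ t := by
    have : (4 * k : ℕ) ≤ t + 10 := by omega
    have : ((4 * k : ℕ) : ℝ) ≤ (t + 10 : ℕ) := by exact_mod_cast this
    push_cast at this
    linarith
  have hprod : ((k : ℝ) - 1) * (4 * k - 10) ≤ (k - 1) * t :=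
    mul_le_mul_of_nonneg_left hkt (by linarith)
  have hne : act (k + 2) ≠ act k := D.game.act_ne hkm (by omega) (by omega) (by omega)
  have hxP : xP (s + (t + 1)) = twoMix (act (k + 2)) (act k)
      (mixWeight (rP (s + (t + 1)) (act (k + 2))) (rP (s + (t + 1)) (act k))) :=
    (D.xP_succ (s + t)).trans
      (rmStrategy_eq_twoMix _ hne hTpos fun a ha ha' => hr3 a ha' ha)
  have hold : (mixSeq (rQ s (act (k + 1))) (rQ s (act (k - 1))) t).2 ≤ 0 :=
    h.mixSeq_snd_nonpos hk ht
  have hxQ : xQ (s + t) = Pi.single (act (k + 1)) 1 := by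
    rw [hQ.x_eq, mixWeight_of_nonpos _ hold, twoMix_zero]
  -- For N = 2k-5, N/2 + 2 = k - 1/2 = (k+1) - 3/2, as the next phase requires of its pure action.
  have hnew : (mixSeq (rQ s (act (k + 1))) (rQ s (act (k - 1))) t).1 ≤ k - 1 / 2 := by
    refine (mixSeq_fst_le h.rQ_pos h.rQ_le (h.rQ_old_le_half hk) t).trans ?_
    rw [Nat.cast_sub (by omega)]
    push_cast
    linarith
  have hnewpos := mixSeq_pos (c := rQ s (act (k - 1))) h.rQ_pos t
  have hnonpos : ∀ b, b ≠ act (k + 1) → rQ (s + t) b ≤ 0 := by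
    intro b hb
    by_cases hb' : b = act (k - 1)
    · rw [hb', hQ.r_old]
      exact hold
    · exact hQ.nonpos b hb hb'
  -- the last update of the second player
  have hlast : rQ (s + (t + 1)) (act (k + 1)) = rQ (s + t) (act (k + 1)) ∧
      (∀ b, b ≠ act (k + 1) → labQ b ≠ k + 3 → rQ (s + (t + 1)) b ≤ rQ (s + t) b) ∧
      (∀ b, labQ b = k + 3 → rQ (s + (t + 1)) b ≤ rQ (s + t) b + 1) ∧
      (∀ b, k + 4 ≤ labQ b → rQ (s + (t + 1)) b ≤ rQ (s + t) b - (k - 1)) := by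
    have hr' := D.rQ_succ (s + t)
    rw [add_assoc, hxQ] at hr'
    have hcases : δQ = 0 ∨ δQ = 1 := by have := D.delay; omega
    rw [hr']
    refine ⟨regretUpdate_single_self _ _ _, ?_⟩
    rcases hcases with h0 | h0 <;> rw [h0]
    -- The second player still observes pure play of k; its own pure strategy is the mixture with q
    -- = 0.
    · rw [add_zero, hP.x_eq, ← twoMix_zero _ (act (k - 1))]
      refine ⟨fun b hb _ => ?_, fun b hb => ?_, fun b hb => ?_⟩
      · by_cases hb' : b = act (k - 1)
        · rw [hb', D.game.transpose.regret_mixed_old (by omega) (by omega) (by omega)]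
          linarith
        · exact D.game.transpose.regret_mixed_le (by omega) (by omega) (by omega) zero_le_one _
            hb hb'
      · have := D.game.transpose.regret_mixed_far (k := k) (by omega) (by omega) (by omega)
          zero_le_one (rQ (s + t)) (a := b) (by omega)
        linarith
      · exact D.game.transpose.regret_mixed_far (k := k) (by omega) (by omega) (by omega)
          zero_le_one (rQ (s + t)) (a := b) (by omega)
    -- The second player already faces the mixture of k+2 and k. This is a round of the kind found
    -- in phase k+1, where k+3 may gain up to 1.
    · rw [add_assoc s t 1, hxP]
      have hp0 := mixWeight_nonneg hTpos (rP (s + (t + 1)) (act k))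
      have hp1 := (mixWeight_lt_one hTpos (rP (s + (t + 1)) (act k))).le
      refine ⟨fun b hb hb' => ?_, fun b hb => ?_, fun b hb => ?_⟩
      · exact D.game.transpose.regret_pure_le (k := k + 1) (by omega) (by omega) (by omega)
          hp0 hp1 _ hb hb'
      · exact D.game.transpose.regret_pure_next_le (k := k + 1) (by omega) (by omega) (by omega)
          hp0 hp1 _ hb
      · have := D.game.transpose.regret_pure_far (k := k + 1) (by omega) (by omega) (by omega)
          hp1 (rQ (s + t)) (a := b) (by omega)
        refine this.trans ?_
        push_cast
        linarith
  obtain ⟨hl1, hl2, hl3, hl4⟩ := hlast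
  refine ⟨t + 1, hET, fun i hi => ?_, ?_⟩
  · obtain ⟨hPi, hQi⟩ := hrun i (by omega)
    have hpi := mixSeq_pos (c := rQ s (act (k - 1))) h.rQ_pos i
    exact ⟨hPi.x_eq, _, mixWeight_nonneg hpi _, mixWeight_lt_one hpi _, Or.inl (by omega),
      hQi.x_eq⟩
  · have hnp : ∀ b, b ≠ act (k + 1) → rQ (s + (t + 1)) b ≤ 0 := by
      intro b hb
      by_cases hb' : labQ b = k + 3
      · have h1 := hl3 b hb'
        have h2 := hQ.far b (by omega)
        nlinarith
      · exact (hl2 b hb hb').trans (hnonpos b hb)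
    refine ⟨?_, ?_, ?_, hnp, fun b hb => ?_, fun b hb => ?_, hxP, hTpos, ?_, ?_, ?_, ?_⟩
    · exact (D.xQ_succ (s + t)).trans
        (rmStrategy_eq_single _ (by rw [← add_assoc] at hl1; rw [hl1, hQ.r_new]; exact hnewpos) hnp)
    · rw [hl1, hQ.r_new]
      exact hnewpos
    · rw [hl1, hQ.r_new]
      push_cast
      linarith
    -- Initial debt 4k-8, then k-1 in each of the first T-1 rounds, less a gain of at most 1 in the
    -- last: (k-1)T + 3k - 8.
    · have h1 := hl3 b hb
      have h2 := hQ.far b (by omega)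
      push_cast
      linarith
    · have h1 := hl4 b (by omega)
      have h2 := hQ.far b (by omega)
      push_cast
      nlinarith
    · rw [hr2]
      have := hTmin t t.lt_succ_self
      have : 0 ≤ (k : ℝ) * mixWeight (mixSeq (rQ s (act (k + 1))) (rQ s (act (k - 1))) i).1
        (mixSeq (rQ s (act (k + 1))) (rQ s (act (k - 1))) i).2 := by positivity
      linarith
    -- Pure play leaves the regret of the played action unchanged, and k - 3/2 = (k+1) - 5/2.
    · rw [Nat.add_sub_cancel, hr1]
      have := h.rP_le
      push_cast
      linarith
    · exact fun b hb hb' => hr3 b hb' hb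
    · intro b hb
      have h1 := hr5 b (by omega)
      push_cast at h1 ⊢
      nlinarith

end Phase

end IsPathDynamics

/-! ### The spiral game as a path game -/

/-- Position of the action `a` of the spiral game in the order in which the spiral visits the rows
(or the columns), counted from `1`. The extra action `m` has position `0`. -/
def spiralRank (m a : ℕ) : ℕ :=
  if a < m then (if 2 * a < m then 2 * a + 1 else 2 * (m - 1 - a) + 2)
  else if a = m then 0 else a

/-- Removing the outer layer lowers all ranks by 2 and raises the offset k by 4, which cancel in
both formulas. -/
lemma spiral_eq (p k a b : ℕ) (ha : a < 2 * p + 2) (hb : b < 2 * p + 2) :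
    spiral (2 * p + 2) k a b =
      if spiralRank (2 * p + 2) a = spiralRank (2 * p + 2) b then
        k + 2 * spiralRank (2 * p + 2) b - 1
      else if spiralRank (2 * p + 2) a = spiralRank (2 * p + 2) b + 1 then
        k + 2 * spiralRank (2 * p + 2) b
      else 0 := by
  induction p generalizing k a b with
  | zero =>
    have ha' : a = 0 ∨ a = 1 := by omega
    have hb' : b = 0 ∨ b = 1 := by omega
    rcases ha' with rfl | rfl <;> rcases hb' with rfl | rfl <;> simp [spiral, spiralRank]
  | succ p ih =>
    have hrank : ∀ c, 1 ≤ c → c ≤ 2 * p + 2 →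
        spiralRank (2 * (p + 1) + 2) c = spiralRank (2 * p + 2) (c - 1) + 2 := by
      intro c h1 h2
      unfold spiralRank
      split_ifs <;> omega
    have hunfold : spiral (2 * (p + 1) + 2) k a b =
      if a = 0 ∧ b = 0 then k + 1
      else if a = 2 * p + 3 ∧ b = 0 then k + 2
      else if a = 2 * p + 3 ∧ b = 2 * p + 3 then k + 3
      else if a = 1 ∧ b = 2 * p + 3 then k + 4
      else if 1 ≤ a ∧ a ≤ 2 * p + 2 ∧ 1 ≤ b ∧ b ≤ 2 * p + 2 then
        spiral (2 * p + 2) (k + 4) (a - 1) (b - 1)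
      else 0 := by
      rw [show 2 * (p + 1) + 2 = 2 * p + 1 + 3 by ring, spiral]
    rw [hunfold]
    by_cases hmid : 1 ≤ a ∧ a ≤ 2 * p + 2 ∧ 1 ≤ b ∧ b ≤ 2 * p + 2
    · rw [if_neg (by omega), if_neg (by omega), if_neg (by omega), if_neg (by omega),
        if_pos hmid, ih _ _ _ (by omega) (by omega), hrank a (by omega) (by omega),
        hrank b (by omega) (by omega)]
      split_ifs <;> omega
    · rw [if_neg hmid]
      unfold spiralRank
      rw [if_pos ha, if_pos hb]
      split_ifs <;> omega

lemma spiralRank_injOn {m a b : ℕ} (hm : Even m) (ha : a < m + 2) (hb : b < m + 2)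
    (h : spiralRank m a = spiralRank m b) : a = b := by
  obtain ⟨p, rfl⟩ := hm
  unfold spiralRank at h
  split_ifs at h <;> omega

lemma spiralRank_le {m a : ℕ} (ha : a < m) : 1 ≤ spiralRank m a ∧ spiralRank m a ≤ m := by
  unfold spiralRank
  rw [if_pos ha]
  split_ifs <;> omega

/-- Truncated subtraction puts the row m, of rank 0, at position 0. The dummy action m+1 lands at
2m+1 or 2m+2, beyond the end of the path, where `pathPay` vanishes. -/
lemma spiralGame_eq_pathPay {m n : ℕ} (hm : Even m) (h2 : 2 ≤ m) (hn : n ≤ m + 2) (a b : Fin n) :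
    spiralGame m n a b = pathPay m (2 * spiralRank m a - 1) (2 * spiralRank m b) := by
  obtain ⟨p, rfl⟩ : ∃ p, m = 2 * p + 2 := by
    obtain ⟨r, rfl⟩ := hm
    exact ⟨r - 1, by omega⟩
  have ha2 := a.isLt
  have hb2 := b.isLt
  simp only [spiralGame, Matrix.of_apply]
  by_cases hab : a.val < 2 * p + 2 ∧ b.val < 2 * p + 2
  · obtain ⟨ha1, ha3⟩ := spiralRank_le hab.1
    obtain ⟨hb1, hb3⟩ := spiralRank_le hab.2
    rw [if_pos hab, spiral_eq p 0 _ _ hab.1 hab.2]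
    have hne : ¬(2 * spiralRank (2 * p + 2) a - 1 = 0 ∨ 2 * spiralRank (2 * p + 2) b = 0) := by
      omega
    unfold pathPay
    rw [if_neg hne]
    split_ifs <;> first | (exfalso; omega) | skip
    · congr 1; omega
    · congr 1; omega
    · simp
  · rw [if_neg hab]
    by_cases h1 : (a.val = 2 * p + 2 ∧ b.val = 0) ∨ (a.val = 0 ∧ b.val = 2 * p + 2)
    · rw [if_pos h1]
      rcases h1 with ⟨h, h'⟩ | ⟨h, h'⟩ <;> simp [h, h', spiralRank, pathPay]
    · rw [if_neg h1]
      symm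
      unfold pathPay spiralRank
      split_ifs <;> first | rfl | (exfalso; omega)

/-- The labels with which the spiral game is a path game. -/
lemma exists_isPathGame {m n : ℕ} (hm : Even m) (h2 : 2 ≤ m) (hmn : m < n) (hn : n ≤ m + 2) :
    ∃ act : ℕ → Fin n, (act 0).val = m ∧
      IsPathGame m 1 (spiralGame m n) (fun a => 2 * spiralRank m a - 1)
        (fun b => 2 * spiralRank m b) act := by
  have hex : ∀ k, ∃ a : Fin n, k ≤ 2 * m → spiralRank m a = (k + 1) / 2 := by
    intro k
    obtain ⟨p, rfl⟩ := hm
    by_cases hk : k ≤ 2 * (p + p)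
    -- The inverse of `spiralRank`: rank 0 is the action m, an odd rank r the action (r-1)/2, an
    -- even one m - r/2.
    · refine ⟨⟨if (k + 1) / 2 = 0 then p + p else if (k + 1) / 2 % 2 = 1 then ((k + 1) / 2 - 1) / 2
        else p + p - (k + 1) / 2 / 2, by split_ifs <;> omega⟩, fun _ => ?_⟩
      simp only [spiralRank]
      split_ifs <;> omega
    · exact ⟨⟨0, by omega⟩, fun h => absurd h hk⟩
  choose act hact using hex
  have hinj : ∀ a b : Fin n, spiralRank m a = spiralRank m b → a = b := fun a b h =>
    Fin.ext (spiralRank_injOn hm (by omega) (by omega) h)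
  have h0 : ∀ a : Fin n, spiralRank m a = 0 → a.val = m := by
    intro a ha
    unfold spiralRank at ha
    split_ifs at ha <;> omega
  refine ⟨act, h0 _ (hact 0 (by omega)), spiralGame_eq_pathPay hm h2 hn, fun a b h => ?_,
    fun a b h => hinj a b (by simpa using h), fun k hk he => ?_, fun k hk he => ?_⟩
  · have : 2 * spiralRank m a - 1 = 2 * spiralRank m b - 1 := h
    exact hinj a b (by omega)
  · have := hact k hk
    change 2 * spiralRank m (act k) - 1 = k
    omega
  · have := hact k hk
    change 2 * spiralRank m (act k) = k
    omega

/-! ### Payoffs and equilibria within a phase -/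

section InPhase

variable {n m e : ℕ} {M : Matrix (Fin n) (Fin n) ℝ} {labP labQ : Fin n → ℕ} {act : ℕ → Fin n}

lemma IsApproxNash.transpose {ε : ℝ} {x y : Fin n → ℝ} (h : IsApproxNash M ε x y) :
    IsApproxNash Mᵀ ε y x := by
  have key : ∀ v w : Fin n → ℝ, v ⬝ᵥ (Mᵀ *ᵥ w) = w ⬝ᵥ (M *ᵥ v) := fun v w => by
    rw [mulVec_transpose, dotProduct_comm, dotProduct_mulVec]
  obtain ⟨h1, h2, h3, h4⟩ := h
  refine ⟨h2, h1, fun y' hy' => ?_, fun x' hx' => ?_⟩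
  · rw [key, key]
    exact h4 y' hy'
  · rw [key, key]
    exact h3 x' hx'

lemma InPhase.payoff_le {k : ℕ} (hk : 1 ≤ k) (hkm : k + 1 ≤ 2 * m) (he : (k + e) % 2 = 0)
    {xP xQ : Fin n → ℝ} (h : InPhase k act xP xQ) (G : IsPathGame m e M labP labQ act)
    {a b : Fin n} (ha : 0 < xP a) (hb : 0 < xQ b) : M a b ≤ k := by
  obtain ⟨hP, q, hq0, hq1, hkq, hQ⟩ := h
  have ha' : a = act k := by
    by_contra hne
    rw [hP, Pi.single_eq_of_ne hne] at ha
    exact lt_irrefl _ ha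
  rw [ha', G.pay, G.actP k (by omega) he]
  by_cases hb1 : b = act (k + 1)
  · rw [hb1, G.actQ _ hkm (by omega), pathPay_succ hk hkm]
  · by_cases hb2 : b = act (k - 1) ∧ 2 ≤ k
    · rw [hb2.1, G.actQ _ (by omega) (by omega), pathPay_pred hb2.2 (by omega)]
      linarith
    · exfalso
      rw [hQ, twoMix, Pi.add_apply, Pi.smul_apply, Pi.smul_apply, Pi.single_eq_of_ne hb1] at hb
      rcases hkq with hk2 | hq
      · rw [Pi.single_eq_of_ne fun h => hb2 ⟨h, hk2⟩] at hb
        simp at hb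
      · simp [hq] at hb

/-- Moving to k+1 gains the opponent q, and moving to k+2 gains the owner of k exactly 1 - kq. Both
being at most ε would force 1 ≤ (k+1)ε. -/
lemma InPhase.not_isApproxNash {k : ℕ} (hk : 1 ≤ k) (hkm : k + 2 ≤ 2 * m)
    (he : (k + e) % 2 = 0) {xP xQ : Fin n → ℝ} (h : InPhase k act xP xQ)
    (G : IsPathGame m e M labP labQ act) {ε : ℝ} (hε : (k + 1) * ε < 1) :
    ¬ IsApproxNash M ε xP xQ := by
  rintro ⟨-, -, h3, h4⟩
  obtain ⟨hP, q, hq0, hq1, hkq, hQ⟩ := h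
  have hk' : (1 : ℝ) ≤ k := by exact_mod_cast hk
  have hold : q * pathPay m k (k - 1) = q * (k - 1) := by
    rcases hkq with hk2 | hq
    · rw [pathPay_pred hk2 (by omega)]
    · rw [hq, zero_mul, zero_mul]
  have hfar : q * pathPay m (k + 2) (k - 1) = 0 := by
    rcases hkq with hk2 | hq
    · rw [pathPay_eq_zero (by omega) (by omega), mul_zero]
    · rw [hq, zero_mul]
  have hqold : q * M (act k) (act (k - 1)) = q * (k - 1) := by
    rw [G.pay, G.actP k (by omega) he, G.actQ _ (by omega) (by omega), hold]
  have hqfar : q * M (act (k + 2)) (act (k - 1)) = 0 := by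
    rw [G.pay, G.actP (k + 2) hkm (by omega), G.actQ (k - 1) (by omega) (by omega), hfar]
  have hM1 : M (act k) (act (k + 1)) = k := by
    rw [G.pay, G.actP k (by omega) he, G.actQ (k + 1) (by omega) (by omega),
      pathPay_succ hk (by omega)]
  have hM2 : M (act (k + 2)) (act (k + 1)) = k + 1 := by
    rw [G.pay, G.actP (k + 2) hkm (by omega), G.actQ (k + 1) (by omega) (by omega),
      pathPay_comm, pathPay_succ (by omega) hkm]
    push_cast
    ring
  have g1 := h3 _ (single_mem_stdSimplex ℝ (act (k + 2)))
  have g2 := h4 _ (single_mem_stdSimplex ℝ (act (k + 1)))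
  rw [hP, hQ, single_one_dotProduct, single_one_dotProduct, mulVec_twoMix, mulVec_twoMix,
    hqold, hqfar, hM1, hM2] at g1
  rw [hP, hQ, single_one_dotProduct, single_one_dotProduct, mulVec_twoMix, hqold, hM1,
    mulVec_single_one, Matrix.col_apply, hM1] at g2
  nlinarith

lemma PhaseStart.inPhase {k : ℕ} (hk : 2 ≤ k) {E : ℝ} {rP xP rQ xQ : Fin n → ℝ}
    (h : PhaseStart k E labP labQ act rP xP rQ xQ) : InPhase k act xP xQ :=
  ⟨h.xP_eq, _, mixWeight_nonneg h.rQ_pos _, mixWeight_lt_one h.rQ_pos _, Or.inl hk, h.xQ_eq⟩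

lemma InPhase.plays {k : ℕ} (hk : 1 ≤ k) (hkm : k + 1 ≤ 2 * m) (he : (k + e) % 2 = 0)
    {xP xQ : Fin n → ℝ} (h : InPhase k act xP xQ) (G : IsPathGame m e M labP labQ act) :
    M (act k) (act (k + 1)) = k ∧ 0 < xP (act k) ∧ 0 < xQ (act (k + 1)) := by
  obtain ⟨hP, q, hq0, hq1, hkq, hQ⟩ := h
  have hne : act (k + 1) ≠ act (k - 1) := G.act_ne hkm (by omega) (by omega) (by omega)
  refine ⟨?_, by simp [hP], ?_⟩
  · rw [G.pay, G.actP k (by omega) he, G.actQ (k + 1) hkm (by omega), pathPay_succ hk hkm]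
  · simp [hQ, twoMix, Pi.single_eq_of_ne hne, hq1]

end InPhase

/-! ### The first rounds -/

namespace IsPathDynamics

variable {n m : ℕ} {M : Matrix (Fin n) (Fin n) ℝ} {labP labQ : Fin n → ℕ} {act : ℕ → Fin n}
  {δQ : ℕ} {rP xP rQ xQ : ℕ → Fin n → ℝ}

/-- If the player who owns the odd positions updates first and the players start outside of the
path, then the first profile of payoff `3` is reached after a few rounds. -/
theorem exists_phaseStart_three (D : IsPathDynamics m 1 M labP labQ act 0 δQ rP xP rQ xQ)
    (hm : 4 ≤ m) {z : Fin n} (hzP : labP z = 0) (hzQ : labQ z = 0) (hP2 : ∀ a, labP a ≠ 2)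
    (hQ1 : ∀ b, labQ b ≠ 1) (hrP : rP 0 = 0) (hrQ : rQ 0 = 0) (hxP : xP 0 = Pi.single z 1)
    (hxQ : xQ 0 = Pi.single z 1) :
    ∃ s, PhaseStart 3 2 labP labQ act (rP s) (xP s) (rQ s) (xQ s) ∧
      ∀ t < s, t = 0 ∨ InPhase 1 act (xP t) (xQ t) ∨ InPhase 2 act (xQ t) (xP t) := by
  have G := D.game
  have G' := D.game.transpose
  have l1 : labP (act 1) = 1 := G.actP 1 (by omega) rfl
  have l2 : labQ (act 2) = 2 := G.actQ 2 (by omega) rfl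
  have l3 : labP (act 3) = 3 := G.actP 3 (by omega) rfl
  have l4 : labQ (act 4) = 4 := G.actQ 4 (by omega) rfl
  have n31 : act 3 ≠ act 1 := G.act_ne (by omega) (by omega) (by omega) rfl
  have n42 : act 4 ≠ act 2 := G.act_ne (by omega) (by omega) (by omega) rfl
  have u12 : pathPay m 1 2 = 1 := by
    simpa using pathPay_succ (m := m) (k := 1) le_rfl (by omega)
  have u32 : pathPay m 3 2 = 2 := by
    rw [pathPay_comm]
    simpa using pathPay_succ (m := m) (k := 2) (by omega) (by omega)
  have u00 : pathPay m 0 0 = 0 := by simp [pathPay]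
  have u10 : pathPay m 1 0 = 1 / 2 := by simp [pathPay]
  have u01 : pathPay m 0 1 = 1 / 2 := by simp [pathPay]
  have u02 : pathPay m 0 2 = 1 / 2 := by simp [pathPay]
  have u0 : ∀ l, l ≠ 1 → l ≠ 2 → pathPay m l 0 = 0 := by
    intro l h1 h2
    simp [pathPay, h1, h2]
  -- the first round of the first player
  have p1 : ∀ a, rP 1 a = pathPay m (labP a) 0 := by
    intro a
    have h := D.rP_succ 0
    rw [hxP, hxQ, hrP] at h
    rw [h, regretUpdate, single_one_dotProduct, mulVec_single_one]
    simp only [Matrix.col_apply]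
    rw [G.pay, G.pay, hzP, hzQ, u00]
    simp
  have p1a : rP 1 (act 1) = 1 / 2 := by rw [p1, l1, u10]
  have p1o : ∀ a, a ≠ act 1 → rP 1 a = 0 := fun a ha => by
    rw [p1, u0 _ (fun h => ha (G.injP (by rw [h, l1]))) (hP2 a)]
  have x1 : xP 1 = Pi.single (act 1) 1 :=
    (D.xP_succ 0).trans (rmStrategy_eq_single _ (by rw [p1a]; norm_num) fun a ha => (p1o a ha).le)
  -- the first round of the second player, in either mode
  have q1 : ∃ w : ℝ, (δQ = 0 → w = 0) ∧ (δQ = 1 → w = 1 / 2) ∧ rQ 1 (act 2) = 1 / 2 ∧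
      (∀ b, b ≠ act 2 → rQ 1 b ≤ 0) ∧ ∀ b, 4 ≤ labQ b → rQ 1 b = -w := by
    have h := D.rQ_succ 0
    rw [hxQ, hrQ] at h
    have hδ : δQ = 0 ∨ δQ = 1 := by have := D.delay; omega
    rcases hδ with rfl | rfl
    · have q1 : ∀ b, rQ 1 b = pathPay m (labQ b) 0 := by
        intro b
        rw [h, regretUpdate, single_one_dotProduct, hxP, mulVec_single_one]
        simp only [Matrix.col_apply]
        rw [G'.pay, G'.pay, hzP, hzQ, u00]
        simp
      refine ⟨0, fun _ => rfl, fun h => by simp at h, ?_, fun b hb => ?_, fun b hb => ?_⟩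
      · rw [q1, l2, pathPay_comm, u02]
      · rw [q1, u0 _ (hQ1 b) fun h => hb (G.injQ (by rw [h, l2]))]
      · rw [q1, u0 _ (by omega) (by omega), neg_zero]
    · have q1 : ∀ b, rQ 1 b = pathPay m (labQ b) 1 - 1 / 2 := by
        intro b
        rw [h, regretUpdate, single_one_dotProduct, zero_add, x1, mulVec_single_one]
        simp only [Matrix.col_apply]
        rw [G'.pay, G'.pay, hzQ, l1, u01]
        simp
      refine ⟨1 / 2, fun h => by simp at h, fun _ => rfl, ?_, fun b hb => ?_, fun b hb => ?_⟩
      · rw [q1, l2, pathPay_comm, u12]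
        norm_num
      · have := pathPay_le_half (m := m) (i := labQ b) (j := 1)
          (fun h => hb (G.injQ (by rw [h, l2]))) (by omega)
        rw [q1]
        linarith
      · rw [q1, pathPay_eq_zero (by omega) (by omega)]
        norm_num
  obtain ⟨w, hw0, hw1, q1a, q1o, q1f⟩ := q1
  have y1 : xQ 1 = Pi.single (act 2) 1 :=
    (D.xQ_succ 0).trans (rmStrategy_eq_single _ (by rw [q1a]; norm_num) q1o)
  -- the second round of the first player
  have p2 : ∀ a, rP 2 a = rP 1 a + pathPay m (labP a) 2 - 1 := by
    intro a
    have h := D.rP_succ 1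
    rw [x1, add_zero, y1] at h
    rw [h, regretUpdate, single_one_dotProduct, mulVec_single_one]
    simp only [Matrix.col_apply]
    rw [G.pay, G.pay, l1, l2, u12]
  have p2a : rP 2 (act 3) = 1 := by
    rw [p2, p1o _ n31, l3, u32]
    norm_num
  have p2b : rP 2 (act 1) = 1 / 2 := by
    rw [p2, p1a, l1, u12]
    norm_num
  have p2o : ∀ a, a ≠ act 3 → a ≠ act 1 → rP 2 a ≤ 0 := by
    intro a h3 h1
    have := pathPay_le_half (m := m) (i := labP a) (j := 2)
      (fun h => h3 (G.injP (by rw [h, l3])))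
      (Or.inl fun h => h1 (G.injP (by rw [l1]; omega)))
    rw [p2, p1o a h1]
    linarith
  have p2f : ∀ a, 5 ≤ labP a → rP 2 a = -1 := by
    intro a ha
    rw [p2, p1o a (fun h => by rw [h, l1] at ha; omega), pathPay_eq_zero (by omega) (by omega)]
    norm_num
  have x2 : xP 2 = twoMix (act 3) (act 1) (1 / 3) := by
    rw [D.xP_succ 1, rmStrategy_eq_twoMix _ n31 (by rw [p2a]; norm_num) p2o, p2a, p2b, mixWeight,
      max_eq_left (by norm_num)]
    norm_num
  -- a round in which the second player plays position 2 purely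
  have pureStep : ∀ (r : Fin n → ℝ) (q : ℝ), 0 ≤ q → q ≤ 1 → r (act 2) = 1 / 2 →
      (∀ b, b ≠ act 2 → labQ b ≠ 4 → r b ≤ 0) → ∀ v : ℝ, (∀ b, 6 ≤ labQ b → r b = -v) →
      ∀ r', r' = regretUpdate r (Pi.single (act 2) 1) (Mᵀ *ᵥ twoMix (act 3) (act 1) q) →
      r' (act 2) = 1 / 2 ∧ r' (act 4) = r (act 4) + 1 - 2 * q ∧
      (∀ b, b ≠ act 2 → labQ b ≠ 4 → r' b ≤ 0) ∧ ∀ b, 6 ≤ labQ b → r' b = -(v + 2 - q) := by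
    rintro r q hq0 hq1 hr hro v hrf _ rfl
    refine ⟨(regretUpdate_single_self _ _ _).trans hr, ?_, fun b hb hb' => ?_, fun b hb => ?_⟩
    · simpa using G'.regret_pure_next (k := 2) le_rfl (by omega) rfl (by omega) (q := q) r
    · exact (G'.regret_pure_le (k := 2) le_rfl (by omega) rfl hq0 hq1 r hb hb').trans
        (hro b hb hb')
    · have h := G'.regret_pure_far_eq (k := 2) le_rfl (by omega) rfl (q := q) r (a := b)
        (by omega)
      rw [hrf b hb] at h
      refine h.trans ?_
      push_cast
      ring
  -- a round in which the first player mixes the positions 3 and 1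
  have mixedStep : ∀ (r : Fin n → ℝ) (q : ℝ), q ≤ 1 → (∀ a, a ≠ act 3 → a ≠ act 1 → r a ≤ 0) →
      ∀ v : ℝ, (∀ a, 5 ≤ labP a → r a = -v) →
      ∀ r', r' = regretUpdate r (twoMix (act 3) (act 1) q) (M *ᵥ Pi.single (act 2) 1) →
      r' (act 3) = r (act 3) + q ∧ r' (act 1) = r (act 1) - (1 - q) ∧
      (∀ a, a ≠ act 3 → a ≠ act 1 → r' a ≤ 0) ∧ ∀ a, 5 ≤ labP a → r' a = -(v + 2 - q) := by
    rintro r q hq1 hro v hrf _ rfl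
    refine ⟨G.regret_mixed_new (k := 2) le_rfl (by omega) rfl r,
      G.regret_mixed_old (k := 2) le_rfl (by omega) rfl r, fun a ha ha' => ?_, fun a ha => ?_⟩
    · exact (G.regret_mixed_le (k := 2) le_rfl (by omega) rfl hq1 r ha ha').trans (hro a ha ha')
    · have h := G.regret_mixed_far_eq (k := 2) le_rfl (by omega) rfl (q := q) r (a := a)
        (by omega)
      rw [hrf a ha] at h
      refine h.trans ?_
      push_cast
      ring
  -- if the second player is at position 2 after two rounds
  have third : xQ 2 = Pi.single (act 2) 1 → rP 3 (act 3) = 4 / 3 ∧ (∀ a, a ≠ act 3 → rP 3 a ≤ 0) ∧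
      (∀ a, 5 ≤ labP a → rP 3 a = -(8 / 3)) ∧ xP 3 = Pi.single (act 3) 1 := by
    intro y2
    have h := D.rP_succ 2
    rw [x2, add_zero, y2] at h
    obtain ⟨ha, hb, ho, hf⟩ := mixedStep _ _ (by norm_num) p2o 1 p2f _ h
    have ho' : ∀ a, a ≠ act 3 → rP 3 a ≤ 0 := by
      intro a h3
      by_cases h1 : a = act 1
      · rw [h1, hb, p2b]
        norm_num
      · exact ho a h3 h1
    have ha' : rP 3 (act 3) = 4 / 3 := by rw [ha, p2a]; norm_num
    exact ⟨ha', ho', fun a ha => by rw [hf a ha]; norm_num,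
      (D.xP_succ 2).trans (rmStrategy_eq_single _ (by rw [ha']; norm_num) ho')⟩
  have phase1 : InPhase 1 act (xP 1) (xQ 1) :=
    ⟨x1, 0, le_rfl, one_pos, Or.inr rfl, by rw [y1, twoMix_zero]⟩
  have phase2 : xQ 2 = Pi.single (act 2) 1 → InPhase 2 act (xQ 2) (xP 2) := fun y2 =>
    ⟨y2, 1 / 3, by norm_num, by norm_num, Or.inl le_rfl, x2⟩
  have nonpos_of : ∀ r : Fin n → ℝ, r (act 4) ≤ 0 → (∀ b, b ≠ act 2 → labQ b ≠ 4 → r b ≤ 0) →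
      ∀ b, b ≠ act 2 → r b ≤ 0 := by
    intro r h4 ho b hb
    by_cases hb' : labQ b = 4
    · rwa [G.injQ (hb'.trans l4.symm)]
    · exact ho b hb hb'
  -- Phase 3 starts when position 4 gets positive regret. With simultaneous updates this regret is
  -- -1, -2/3, 1/3 after rounds 2, 3, 4; with alternating ones it is -1/2, -1/6, 5/6 after rounds 1,
  -- 2, 3.
  have hδ : δQ = 0 ∨ δQ = 1 := by have := D.delay; omega
  rcases hδ with rfl | rfl
  · obtain rfl := hw0 rfl
    have h2 := D.rQ_succ 1
    rw [y1, add_zero, x1] at h2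
    have q2 : ∀ b, rQ 2 b = rQ 1 b + pathPay m (labQ b) 1 - 1 := by
      intro b
      rw [h2, regretUpdate, single_one_dotProduct, mulVec_single_one]
      simp only [Matrix.col_apply]
      rw [G'.pay, G'.pay, l1, l2, pathPay_comm m 2, u12]
    have q2a : rQ 2 (act 2) = 1 / 2 := by
      rw [q2, q1a, l2, pathPay_comm, u12]
      norm_num
    have q2f : ∀ b, 4 ≤ labQ b → rQ 2 b = -1 := by
      intro b hb
      rw [q2, q1f b hb, pathPay_eq_zero (by omega) (by omega)]
      norm_num
    have q2o : ∀ b, b ≠ act 2 → rQ 2 b ≤ 0 := by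
      intro b hb
      have h1 := pathPay_le_half (m := m) (i := labQ b) (j := 1)
        (fun h => hb (G.injQ (by rw [h, l2]))) (by omega)
      have := q1o b hb
      rw [q2]
      linarith
    have y2 : xQ 2 = Pi.single (act 2) 1 :=
      (D.xQ_succ 1).trans (rmStrategy_eq_single _ (by rw [q2a]; norm_num) q2o)
    obtain ⟨p3a, p3o, p3f, x3⟩ := third y2
    have h3 := D.rQ_succ 2
    rw [y2, add_zero, x2] at h3
    obtain ⟨q3a, q3b, q3o, q3f⟩ := pureStep _ _ (by norm_num) (by norm_num) q2a
      (fun b hb _ => q2o b hb) 1 (fun b hb => q2f b (by omega)) _ h3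
    have q3b' : rQ 3 (act 4) = -(2 / 3) := by
      rw [q3b, q2f _ (by rw [l4])]
      norm_num
    have y3 : xQ 3 = Pi.single (act 2) 1 :=
      (D.xQ_succ 2).trans (rmStrategy_eq_single _ (by rw [q3a]; norm_num)
        (nonpos_of _ (by rw [q3b']; norm_num) q3o))
    have h4 := D.rQ_succ 3
    rw [y3, add_zero, x3, ← twoMix_zero (act 3) (act 1)] at h4
    obtain ⟨q4a, q4b, q4o, q4f⟩ := pureStep _ _ le_rfl zero_le_one q3a q3o _ q3f _ h4
    have g4 := D.rP_succ 3
    rw [x3, ← twoMix_zero (act 3) (act 1), add_zero, y3] at g4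
    obtain ⟨p4a, p4b, p4o, p4f⟩ := mixedStep _ _ zero_le_one (fun a h _ => p3o a h) _ p3f _ g4
    have p4a' : rP 4 (act 3) = 4 / 3 := by rw [p4a, p3a]; norm_num
    have q4b' : rQ 4 (act 4) = 1 / 3 := by rw [q4b, q3b']; norm_num
    have p4o' : ∀ a, a ≠ act 3 → rP 4 a ≤ 0 := by
      intro a h3
      by_cases h1 : a = act 1
      · rw [h1, p4b]
        have := p3o _ n31.symm
        linarith
      · exact p4o a h3 h1
    have q4o' : ∀ b, b ≠ act 4 → b ≠ act 2 → rQ 4 b ≤ 0 := fun b hb hb' =>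
      q4o b hb' fun h => hb (G.injQ (h.trans l4.symm))
    refine ⟨4, ⟨?_, ?_, ?_, p4o', fun a ha => ?_, fun a ha => ?_, ?_, ?_, ?_, ?_, q4o',
      fun b hb => ?_⟩, fun t ht => ?_⟩
    · exact (D.xP_succ 3).trans (rmStrategy_eq_single _ (by rw [p4a']; norm_num) p4o')
    · rw [p4a']; norm_num
    · rw [p4a']; norm_num
    · rw [p4f a (by omega)]; norm_num
    · rw [p4f a (by omega)]; norm_num
    · exact (D.xQ_succ 3).trans (rmStrategy_eq_twoMix _ n42 (by rw [q4b']; norm_num) q4o')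
    · show 0 < rQ 4 (act 4)
      rw [q4b']; norm_num
    · show rQ 4 (act 4) ≤ 1
      rw [q4b']; norm_num
    · show rQ 4 (act 2) ≤ _
      rw [q4a]; norm_num
    · rw [q4f b (by omega)]; norm_num
    · interval_cases t
      · exact Or.inl rfl
      · exact Or.inr (Or.inl phase1)
      · exact Or.inr (Or.inr (phase2 y2))
      · refine Or.inr (Or.inr ⟨y3, 0, le_rfl, one_pos, Or.inr rfl, ?_⟩)
        rw [x3]
        exact (twoMix_zero _ _).symm
  · obtain rfl := hw1 rfl
    have h2 := D.rQ_succ 1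
    rw [y1, x2] at h2
    obtain ⟨q2a, q2b, q2o, q2f⟩ := pureStep _ _ (by norm_num) (by norm_num) q1a
      (fun b hb _ => q1o b hb) _ (fun b hb => q1f b (by omega)) _ h2
    have q2b' : rQ 2 (act 4) = -(1 / 6) := by
      rw [q2b, q1f _ (by rw [l4])]
      norm_num
    have y2 : xQ 2 = Pi.single (act 2) 1 :=
      (D.xQ_succ 1).trans (rmStrategy_eq_single _ (by rw [q2a]; norm_num)
        (nonpos_of _ (by rw [q2b']; norm_num) q2o))
    obtain ⟨p3a, p3o, p3f, x3⟩ := third y2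
    have h3 := D.rQ_succ 2
    rw [y2, x3, ← twoMix_zero (act 3) (act 1)] at h3
    obtain ⟨q3a, q3b, q3o, q3f⟩ := pureStep _ _ le_rfl zero_le_one q2a q2o _ q2f _ h3
    have q3b' : rQ 3 (act 4) = 5 / 6 := by rw [q3b, q2b']; norm_num
    have q3o' : ∀ b, b ≠ act 4 → b ≠ act 2 → rQ 3 b ≤ 0 := fun b hb hb' =>
      q3o b hb' fun h => hb (G.injQ (h.trans l4.symm))
    refine ⟨3, ⟨x3, ?_, ?_, p3o, fun a ha => ?_, fun a ha => ?_, ?_, ?_, ?_, ?_, q3o',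
      fun b hb => ?_⟩, fun t ht => ?_⟩
    · rw [p3a]; norm_num
    · rw [p3a]; norm_num
    · rw [p3f a (by omega)]; norm_num
    · rw [p3f a (by omega)]; norm_num
    · exact (D.xQ_succ 2).trans (rmStrategy_eq_twoMix _ n42 (by rw [q3b']; norm_num) q3o')
    · show 0 < rQ 3 (act 4)
      rw [q3b']; norm_num
    · show rQ 3 (act 4) ≤ 1
      rw [q3b']; norm_num
    · show rQ 3 (act 2) ≤ _
      rw [q3a]; norm_num
    · rw [q3f b (by omega)]; norm_num
    · interval_cases t
      · exact Or.inl rfl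
      · exact Or.inr (Or.inl phase1)
      · exact Or.inr (Or.inr (phase2 y2))

end IsPathDynamics

/-! ### Iterating the phases -/

namespace IsPathDynamics

variable {n m : ℕ} {M : Matrix (Fin n) (Fin n) ℝ} {labP labQ : Fin n → ℕ} {act : ℕ → Fin n}
  {δP δQ : ℕ} {rP xP rQ xQ : ℕ → Fin n → ℝ}

/-- Starting from the phase of payoff `3`, the phases of all payoffs up to `2m - 1` are reached.
Here `S k E t` and `I k t` say that phase `k` starts at time `t` and that time `t` is in it. -/
theorem exists_phaseStart (D : IsPathDynamics m 1 M labP labQ act δP δQ rP xP rQ xQ)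
    {S : ℕ → ℝ → ℕ → Prop} {I : ℕ → ℕ → Prop}
    (hS : ∀ k E t, S k E t ↔
      (k % 2 = 1 ∧ PhaseStart k E labP labQ act (rP t) (xP t) (rQ t) (xQ t)) ∨
      (k % 2 = 0 ∧ PhaseStart k E labQ labP act (rQ t) (xQ t) (rP t) (xP t)))
    (hI : ∀ k t, I k t ↔ (k % 2 = 1 ∧ InPhase k act (xP t) (xQ t)) ∨
      (k % 2 = 0 ∧ InPhase k act (xQ t) (xP t)))
    {k : ℕ} (hk : 3 ≤ k) (hkm : k + 2 ≤ 2 * m) {E : ℝ} {s : ℕ} (h : S k E s)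
    (hE : 4 * k - 10 ≤ E) :
    ∃ T : ℕ, E < T ∧ (∀ t < T, I k (s + t)) ∧ S (k + 1) ((k - 1) * T + 3 * k - 8) (s + T) := by
  rcases (hS _ _ _).1 h with ⟨hp, h⟩ | ⟨hp, h⟩
  · obtain ⟨T, h1, h2, h3⟩ := D.exists_next_phaseStart hk hkm (by omega) h hE
    exact ⟨T, h1, fun t ht => (hI _ _).2 (Or.inl ⟨hp, h2 t ht⟩),
      (hS _ _ _).2 (Or.inr ⟨by omega, h3⟩)⟩
  · obtain ⟨T, h1, h2, h3⟩ := D.swap.exists_next_phaseStart hk hkm (by omega) h hE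
    exact ⟨T, h1, fun t ht => (hI _ _).2 (Or.inr ⟨hp, h2 t ht⟩),
      (hS _ _ _).2 (Or.inl ⟨by omega, h3⟩)⟩

end IsPathDynamics

/-- `0` if the second player observes the utility vector given by the first player's old strategy,
`1` if it is the one given by the new strategy. -/
def UpdateMode.delay : UpdateMode → ℕ
  | .simultaneous => 0
  | .alternating => 1

/-- Regret matching on the spiral game runs through phases, where `I k t` says that time `t` is in
phase `k`: phase `k` starts at a time `s` and lasts for `T > (k - 2)!` rounds. -/
theorem spiralRM_phases {m n : ℕ} (mode : UpdateMode) (hm : Even m) (h4 : 4 ≤ m) (hmn : m < n)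
    (hn : n ≤ m + 2) :
    ∃ act : ℕ → Fin n, ∃ labP labQ : Fin n → ℕ,
      IsPathGame m 1 (spiralGame m n) labP labQ act ∧ labP (act 0) = 0 ∧
      pureStrategy n m = Pi.single (act 0) 1 ∧
      ∃ I : ℕ → ℕ → Prop,
        (∀ k t, I k t →
          (k % 2 = 1 ∧ InPhase k act (spiralRM m n mode t).x₁ (spiralRM m n mode t).x₂) ∨
          (k % 2 = 0 ∧ InPhase k act (spiralRM m n mode t).x₂ (spiralRM m n mode t).x₁)) ∧
        ∀ k, 3 ≤ k → k + 2 ≤ 2 * m → ∃ s T : ℕ, ((k - 2).factorial : ℝ) < T ∧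
          (∀ t < s, t = 0 ∨ ∃ j, 1 ≤ j ∧ j < k ∧ I j t) ∧ (∀ t < T, I k (s + t)) ∧
          I (k + 1) (s + T) := by
  obtain ⟨act, hz, G⟩ := exists_isPathGame hm (by omega) hmn hn
  have hr0 : spiralRank m (act 0) = 0 := by
    unfold spiralRank
    rw [hz, if_neg (by omega), if_pos rfl]
  have hpure : pureStrategy n m = Pi.single (act 0) 1 := by
    funext a
    simp only [pureStrategy, Pi.single_apply, Fin.ext_iff, hz]
  have D : IsPathDynamics m 1 (spiralGame m n) (fun a => 2 * spiralRank m a - 1)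
      (fun b => 2 * spiralRank m b) act 0 mode.delay (fun t => (spiralRM m n mode t).r₁)
      (fun t => (spiralRM m n mode t).x₁) (fun t => (spiralRM m n mode t).r₂)
      (fun t => (spiralRM m n mode t).x₂) := by
    refine ⟨G, ?_, fun t => rfl, fun t => rfl, fun t => ?_, fun t => rfl⟩
    · cases mode <;> simp [UpdateMode.delay]
    · cases mode <;> rfl
  obtain ⟨I, hI⟩ : ∃ I : ℕ → ℕ → Prop, ∀ k t, I k t ↔
      (k % 2 = 1 ∧ InPhase k act (spiralRM m n mode t).x₁ (spiralRM m n mode t).x₂) ∨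
      (k % 2 = 0 ∧ InPhase k act (spiralRM m n mode t).x₂ (spiralRM m n mode t).x₁) :=
    ⟨_, fun k t => Iff.rfl⟩
  obtain ⟨S, hS⟩ : ∃ S : ℕ → ℝ → ℕ → Prop, ∀ k E t, S k E t ↔
      (k % 2 = 1 ∧ PhaseStart k E (fun a => 2 * spiralRank m a - 1) (fun b => 2 * spiralRank m b)
        act (spiralRM m n mode t).r₁ (spiralRM m n mode t).x₁ (spiralRM m n mode t).r₂
        (spiralRM m n mode t).x₂) ∨
      (k % 2 = 0 ∧ PhaseStart k E (fun b => 2 * spiralRank m b) (fun a => 2 * spiralRank m a - 1)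
        act (spiralRM m n mode t).r₂ (spiralRM m n mode t).x₂ (spiralRM m n mode t).r₁
        (spiralRM m n mode t).x₁) :=
    ⟨_, fun k E t => Iff.rfl⟩
  refine ⟨act, _, _, G, by simp [hr0], hpure, I, fun k t => (hI k t).1, ?_⟩
  have hstart : ∀ k, 3 ≤ k → k + 1 ≤ 2 * m → ∃ s E, S k E s ∧ 4 * (k : ℝ) - 10 ≤ E ∧
      ((k - 2).factorial : ℝ) ≤ E ∧ ∀ t < s, t = 0 ∨ ∃ j, 1 ≤ j ∧ j < k ∧ I j t := by
    intro k hk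
    induction k, hk using Nat.le_induction with
    | base =>
      intro _
      obtain ⟨s, h1, h2⟩ := D.exists_phaseStart_three h4 (z := act 0) (by simp [hr0])
        (by simp [hr0]) (fun a => by omega) (fun b => by omega) rfl rfl hpure hpure
      refine ⟨s, 2, (hS _ _ _).2 (Or.inl ⟨rfl, h1⟩), by norm_num, by norm_num, fun t ht => ?_⟩
      rcases h2 t ht with h | h | h
      · exact Or.inl h
      · exact Or.inr ⟨1, le_rfl, by norm_num, (hI _ _).2 (Or.inl ⟨rfl, h⟩)⟩
      · exact Or.inr ⟨2, by norm_num, by norm_num, (hI _ _).2 (Or.inr ⟨rfl, h⟩)⟩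
    | succ k hk ih =>
      intro hkm
      obtain ⟨s, E, h1, h2, h3, h5⟩ := ih (by omega)
      obtain ⟨T, hT, hin, hnext⟩ := D.exists_phaseStart hS hI hk hkm h1 h2
      have hk' : (3 : ℝ) ≤ k := by exact_mod_cast hk
      refine ⟨s + T, _, hnext, ?_, ?_, fun t ht => ?_⟩
      -- Integrality is needed for k = 3: T > 2 only gives 2T + 1 > 5, whereas the next phase needs
      -- 6.
      · have h2T : (2 : ℝ) < T := by linarith
        have h3T : (3 : ℝ) ≤ T := by
          have : 2 < T := by exact_mod_cast h2T
          exact_mod_cast this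
        push_cast
        nlinarith
      -- The new debt exceeds (k-1)T > (k-1)E ≥ (k-1)·(k-2)!.
      · rw [show k + 1 - 2 = (k - 2) + 1 by omega, Nat.factorial_succ,
          show k - 2 + 1 = k - 1 by omega]
        push_cast [Nat.cast_sub (show 1 ≤ k by omega)]
        nlinarith
      · by_cases hts : t < s
        · rcases h5 t hts with h | ⟨j, hj1, hj2, hj3⟩
          · exact Or.inl h
          · exact Or.inr ⟨j, hj1, by omega, hj3⟩
        · refine Or.inr ⟨k, by omega, by omega, ?_⟩
          have := hin (t - s) (by omega)
          rwa [show s + (t - s) = t by omega] at this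
  intro k hk hkm
  obtain ⟨s, E, h1, h2, h3, h5⟩ := hstart k hk (by omega)
  obtain ⟨T, hT, hin, hnext⟩ := D.exists_phaseStart hS hI hk hkm h1 h2
  refine ⟨s, T, h3.trans_lt hT, h5, hin, (hI _ _).2 ?_⟩
  exact ((hS _ _ _).1 hnext).imp (fun h => ⟨h.1, h.2.inPhase (by omega)⟩)
    fun h => ⟨h.1, h.2.inPhase (by omega)⟩

/-! ### The factorial bound and the theorem -/

/-- With m = 2p, n ≤ 2(p+1) ≤ (p+1)² and n/4 ≤ p, so the left side is at most (p+1)^p ≤ (2p)! ≤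
(4p-4)!. -/
lemma rpow_le_factorial {m n : ℕ} (hm : Even m) (h4 : 4 ≤ m) (hn : n ≤ m + 2) :
    (n : ℝ) ^ (1 / 8 * (n : ℝ)) ≤ ((2 * m - 4).factorial : ℝ) := by
  obtain ⟨p, rfl⟩ := hm
  have hp : (2 : ℝ) ≤ p := by exact_mod_cast (show 2 ≤ p by omega)
  have hn' : (n : ℝ) ≤ 2 * (p + 1) := by
    have : n ≤ 2 * (p + 1) := by omega
    exact_mod_cast this
  have h1 : (p + 1) ^ p ≤ (2 * (p + p) - 4).factorial :=
    calc (p + 1) ^ p ≤ p.factorial * (p + 1) ^ p := Nat.le_mul_of_pos_left _ p.factorial_pos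
      _ ≤ (p + p).factorial := Nat.factorial_mul_pow_le_factorial
      _ ≤ _ := Nat.factorial_le (by omega)
  calc (n : ℝ) ^ (1 / 8 * (n : ℝ)) ≤ (((p : ℝ) + 1) ^ (2 : ℝ)) ^ (1 / 8 * (n : ℝ)) := by
        refine Real.rpow_le_rpow (by positivity) ?_ (by positivity)
        rw [Real.rpow_two]
        nlinarith
    _ = ((p : ℝ) + 1) ^ (2 * (1 / 8 * (n : ℝ))) := (Real.rpow_mul (by positivity) _ _).symm
    _ ≤ ((p : ℝ) + 1) ^ (p : ℝ) :=
        Real.rpow_le_rpow_of_exponent_le (by linarith) (by linarith)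
    _ = (((p + 1) ^ p : ℕ) : ℝ) := by
        rw [Real.rpow_natCast]
        push_cast
        rfl
    _ ≤ _ := by exact_mod_cast h1

theorem mainTheorem5 :
    (∃ c : ℝ, 0 < c ∧
      ∀ (mode : UpdateMode) (m n : ℕ), Even m → 4 ≤ m → (n = m + 1 ∨ n = m + 2) →
        ∀ t : ℕ,
          IsApproxNash (spiralGame m n) (1 / (2 * (n : ℝ)))
              (spiralRM m n mode t).x₁ (spiralRM m n mode t).x₂ →
            (n : ℝ) ^ (c * (n : ℝ)) ≤ (t : ℝ)) ∧
    (∀ (mode : UpdateMode) (m n : ℕ), Even m → 4 ≤ m → (n = m + 1 ∨ n = m + 2) →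
      ∀ k : ℕ, 4 ≤ k → k + 2 ≤ 2 * m →
        ∃ s t : ℕ, IsLeast {i : ℕ | PlaysPayoff m n mode k i} s ∧
          IsLeast {i : ℕ | PlaysPayoff m n mode (k + 1) i} t ∧
          (Nat.factorial (k - 2) : ℝ) / 2 ^ (k - 3) ≤ (t : ℝ) - (s : ℝ)) := by
  refine ⟨⟨1 / 8, by norm_num, fun mode m n hm h4 hn t hNash => ?_⟩,
    fun mode m n hm h4 hn k hk hkm => ?_⟩
  · obtain ⟨act, labP, labQ, G, hz, hpure, I, hI, hph⟩ :=
      spiralRM_phases mode hm h4 (show m < n by omega) (by omega)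
    obtain ⟨s, T, hT, hs, hin, -⟩ := hph (2 * m - 2) (by omega) (by omega)
    have hmn : (m : ℝ) + 1 ≤ n := by
      have : m + 1 ≤ n := by omega
      exact_mod_cast this
    have hn5 : (5 : ℝ) ≤ n := by
      have : 5 ≤ n := by omega
      exact_mod_cast this
    have hnot : ∀ j, 1 ≤ j → j + 2 ≤ 2 * m → ¬ I j t := by
      intro j hj1 hj2 hj
      have hε : ((j : ℝ) + 1) * (1 / (2 * (n : ℝ))) < 1 := by
        have : (j : ℝ) + 2 ≤ 2 * m := by exact_mod_cast hj2
        rw [mul_one_div, div_lt_one (by linarith)]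
        linarith
      rcases hI j t hj with ⟨hp, h⟩ | ⟨hp, h⟩
      · exact h.not_isApproxNash hj1 hj2 (by omega) G hε hNash
      · exact h.not_isApproxNash hj1 hj2 (by omega) G.transpose hε hNash.transpose
    have ht : s + T ≤ t := by
      by_contra! hlt
      by_cases hts : t < s
      · rcases hs t hts with rfl | ⟨j, hj1, hj2, hj⟩
        -- The initial profile pays 0, and moving to position 1 gains 1/2 > 1/(2n).
        · have h3 := hNash.2.2.1 _ (single_mem_stdSimplex ℝ (act 1))
          have e1 : (spiralRM m n mode 0).x₁ = Pi.single (act 0) 1 := hpure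
          have e2 : (spiralRM m n mode 0).x₂ = Pi.single (act 0) 1 := hpure
          rw [e1, e2, single_one_dotProduct, single_one_dotProduct, mulVec_single_one,
            Matrix.col_apply, Matrix.col_apply, G.pay, G.pay, hz,
            G.actP 1 (by omega) rfl, G.actQ 0 (by omega) rfl] at h3
          have : 1 / (2 * (n : ℝ)) < 1 / 2 := by
            apply one_div_lt_one_div_of_lt <;> linarith
          norm_num [pathPay] at h3 this
          linarith
        · exact hnot j hj1 (by omega) hj
      · have := hin (t - s) (by omega)
        rw [show s + (t - s) = t by omega] at this
        exact hnot _ (by omega) (by omega) this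
    have hTt : (T : ℝ) ≤ t := by exact_mod_cast (show T ≤ t by omega)
    rw [show 2 * m - 2 - 2 = 2 * m - 4 by omega] at hT
    exact ((rpow_le_factorial hm h4 (by omega)).trans hT.le).trans hTt
  · obtain ⟨act, labP, labQ, G, hz, hpure, I, hI, hph⟩ :=
      spiralRM_phases mode hm h4 (show m < n by omega) (by omega)
    obtain ⟨s, T, hT, hs, hin, hend⟩ := hph k (by omega) hkm
    have hplays : ∀ j t, 1 ≤ j → j + 1 ≤ 2 * m → I j t → PlaysPayoff m n mode j t := by
      intro j t hj1 hj2 hj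
      rcases hI j t hj with ⟨hp, h⟩ | ⟨hp, h⟩
      · obtain ⟨g1, g2, g3⟩ := h.plays hj1 hj2 (by omega) G
        exact ⟨_, _, g1, g2, g3⟩
      · obtain ⟨g1, g2, g3⟩ := h.plays hj1 hj2 (by omega) G.transpose
        exact ⟨_, _, g1, g3, g2⟩
    have hnot : ∀ j K t, 1 ≤ j → j + 1 ≤ 2 * m → j < K → I j t → ¬ PlaysPayoff m n mode K t := by
      rintro j K t hj1 hj2 hjK hj ⟨a, b, hab, ha, hb⟩
      have hjK' : (j : ℝ) < K := by exact_mod_cast hjK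
      rcases hI j t hj with ⟨hp, h⟩ | ⟨hp, h⟩
      · have := h.payoff_le hj1 hj2 (by omega) G ha hb
        linarith
      · have := h.payoff_le hj1 hj2 (by omega) G.transpose hb ha
        rw [Matrix.transpose_apply] at this
        linarith
    have hnot0 : ∀ K, 1 ≤ K → ¬ PlaysPayoff m n mode K 0 := by
      rintro K hK ⟨a, b, hab, ha, hb⟩
      have e : ∀ c : Fin n, 0 < pureStrategy n m c → c = act 0 := by
        intro c hc
        by_contra hne
        rw [hpure, Pi.single_eq_of_ne hne] at hc
        exact lt_irrefl _ hc
      rw [e a ha, e b hb, G.pay, hz, G.actQ 0 (by omega) rfl] at hab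
      have : (K : ℝ) = 0 := by
        rw [← hab]
        simp [pathPay]
      have : K = 0 := by exact_mod_cast this
      omega
    have hbefore : ∀ K t, k ≤ K → t < s → ¬ PlaysPayoff m n mode K t := by
      intro K t hK ht
      rcases hs t ht with rfl | ⟨j, hj1, hj2, hj⟩
      · exact hnot0 K (by omega)
      · exact hnot j K t hj1 (by omega) (by omega) hj
    have hT0 : 0 < T := by
      have : (0 : ℝ) < T := lt_of_le_of_lt (by positivity) hT
      exact_mod_cast this
    refine ⟨s, s + T, ⟨hplays k s (by omega) (by omega) (hin 0 hT0), fun i hi => ?_⟩,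
      ⟨hplays (k + 1) _ (by omega) (by omega) hend, fun i hi => ?_⟩, ?_⟩
    · by_contra! hlt
      exact hbefore k i le_rfl hlt hi
    · by_contra! hlt
      by_cases his : i < s
      · exact hbefore (k + 1) i k.le_succ his hi
      · have := hin (i - s) (by omega)
        rw [show s + (i - s) = i by omega] at this
        exact hnot k (k + 1) i (by omega) (by omega) k.lt_succ_self this hi
    · push_cast
      rw [add_sub_cancel_left]
      -- The phase even lasts more than (k-2)! rounds; the power of 2 is slack.
      refine le_trans (div_le_self (by positivity) ?_) hT.le
      exact one_le_pow₀ (by norm_num)
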